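/- **Theorem 5.1 (Modified Bohr–Sommerfeld condition).** Let $m\in C^1(\mathbb R)$ be bounded with bounded derivative and strictly increasing, with $m(0)=0$ and $m(x)\to\pm1$ as $x\to\pm\infty$, and let $\sigma_{\mathcal D}\in\{1,-1\}$. For $\varepsilon>0$ and $0<\mathcal E<1$ consider $$-\varepsilon^2\psi''+(m^2+\sigma_{\mathcal D}\,\varepsilon\, m')\psi=\mathcal E\psi ,$$ and suppose that $\mathcal E$ has two simple turning points $x_-<x_+$, that is, $m(x_\pm)^2=\mathcal E$ and $m'(x_\pm)>0$. *WKB functions.* A WKB function on an open interval is $\exp(iS_0/\varepsilon+iS_1)$ with complex-valued $S_0,S_1$ satisfying $(S_0')^2=\mathcal E-m^2$ and $2S_0'S_1'-iS_0''+\sigma_{\mathcal D}m'=0$ there. For $x_\tau\in\{x_-,x_+\}$ put $\lambda=2m(x_\tau)m'(x_\tau)$ and $\zeta=\lambda^{1/3}\varepsilon^{-2/3}(x-x_\tau)$ (real cube root). A WKB function has at $x_\tau$ the linearised form $c\,|\zeta|^{-1/4}e^{\frac23 i s|\zeta|^{3/2}}$ if, as $x\to x_\tau$, $S_0(x)=S_0(x_\tau)+\tfrac23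 s\,\varepsilon|\zeta|^{3/2}(1+o(1))$ and $e^{iS_1(x)}=|\zeta|^{-1/4}(b+o(1))$, where $S_0(x_\tau)$ denotes the limit of $S_0$ and $c=e^{iS_0(x_\tau)/\varepsilon}\,b$. *Global consistency.* The WKB solution is globally consistent with relative error $\eta$ if there are WKB functions $\psi_l$ on $(-\infty,x_-)$ with $\psi_l\to0$ at $-\infty$, $\psi_r$ on $(x_+,\infty)$ with $\psi_r\to0$ at $+\infty$, and $\psi_R,\psi_L$ on $(x_-,x_+)$, with $\operatorname{Re}S_0'>0$ for $\psi_R$ and $\operatorname{Re}S_0'<0$ for $\psi_L$, which are matched at both turning points in the following sense. At each turning point there is a solution $\varphi$ of Airy's equation $\varphi''=\zeta\varphi$ on $\mathbb R$ with $$\varphi(\zeta)=\zeta^{-1/4}e^{-\frac23\zeta^{3/2}}(c+o(1))\quad(\zeta\to+\infty),$$ $$\varphi(\zeta)=|\zeta|^{-1/4}\bigl(c_+e^{\frac23i|\zeta|^{3/2}}+c_-e^{-\frac23i|\zeta|^{3/2}}+o(1)\bigr)\quad(\zeta\to-\infty),$$ such that the adjacent $\psi_l$ or $\psi_r$ has the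 linearised form with $s=i$ and coefficient $c$, and the two functions $\psi_R,\psi_L$ have the linearised forms with $s=\pm1$ and coefficients $d_\pm$ ($s=+1$ for $\psi_R$ at $x_-$ and for $\psi_L$ at $x_+$, and $s=-1$ for the other one), where $|d_\pm-c_\pm|\le\eta\,|c_\pm|$. *Claim.* Global consistency up to a relative error $O(\varepsilon)$ is equivalent to $$\frac1\varepsilon\int_{x_-}^{x_+}\sqrt{\mathcal E-m(x)^2}\,dx=\Bigl(k+\frac{\sigma_{\mathcal D}+1}{2}\Bigr)\pi+O(\varepsilon)\quad\text{for some } k\in\{0,1,2,\dots\},$$ uniformly for $\mathcal E$ bounded away from $0$. Precisely: for all $a>0$ and $K>0$ there are $C>0$ and $\varepsilon_0>0$ such that for all $0<\varepsilon<\varepsilon_0$ and all $\mathcal E\in[a,1)$ with two simple turning points $x_-<x_+$: 1. if the WKB solution is globally consistent with relative error $K\varepsilon$, then for some integer $k\ge0$ the left-hand side above differs from $\bigl(k+\frac{\sigma_{\mathcal D}+1}2\bigr)\pi$ by at most $C\varepsilon$; that is, it differs from $k\pi$ (if $\sigma_{\mathcal D}=-1$) or from $(k+1)\pi$ (if $\sigma_{\mathcal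 D}=+1$) by at most $C\varepsilon$; 2. if, for some integer $k\ge0$, the left-hand side differs from $\bigl(k+\frac{\sigma_{\mathcal D}+1}2\bigr)\pi$ by at most $K\varepsilon$, then the WKB solution is globally consistent with relative error $C\varepsilon$. -/

import Mathlib

open Filter Topology

/-- Admissible mass profiles: `C¹`, bounded with bounded derivative, `m → ±1` at `±∞`,
`m 0 = 0`, strictly increasing. -/
structure IsMassProfile (m : ℝ → ℝ) : Prop where
  contDiff : ContDiff ℝ 1 m
  bounded : ∃ M : ℝ, ∀ x, |m x| ≤ M
  bounded_deriv : ∃ M : ℝ, ∀ x, |deriv m x| ≤ M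
  tendsto_atTop : Tendsto m atTop (𝓝 1)
  tendsto_atBot : Tendsto m atBot (𝓝 (-1))
  map_zero : m 0 = 0
  strictMono : StrictMono m

/-- `x₋ < x₊` are simple turning points of the mass profile `m` at energy `En`. -/
structure AreTurningPoints (m : ℝ → ℝ) (En xm xp : ℝ) : Prop where
  lt : xm < xp
  left : m xm ^ 2 = En
  right : m xp ^ 2 = En
  simple_left : 0 < deriv m xm
  simple_right : 0 < deriv m xp

/-- The first two terms `S₀`, `S₁` of a WKB phase `S = S₀ + ε S₁ + …`. -/
structure WKBPhase where
  S0 : ℝ → ℂ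
  S1 : ℝ → ℂ

/-- The WKB function `exp (i S / ε)` with `S = S₀ + ε S₁`.  A constant amplitude is carried by
the additive constant of `S₁`. -/
noncomputable def WKBPhase.mode (p : WKBPhase) (ε : ℝ) (x : ℝ) : ℂ :=
  Complex.exp (Complex.I * (p.S0 x / ε + p.S1 x))

/-- The phase equations on an open set `U`, i.e. the orders `1` and `ε` obtained by inserting
`ψ = exp (i (S₀ + ε S₁ + …) / ε)` into `-ε² ψ'' + (m² + σ ε m') ψ = En ψ`:
`(S₀')² = En - m²` and `2 S₀' S₁' - i S₀'' + σ m' = 0`.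
The values are complex, so that classically allowed and forbidden regions are both covered. -/
structure WKBPhase.Solves (p : WKBPhase) (m : ℝ → ℝ) (σ : ℤ) (En : ℝ) (U : Set ℝ) : Prop where
  diff_S0 : ∀ x ∈ U, DifferentiableAt ℝ p.S0 x
  diff_deriv_S0 : ∀ x ∈ U, DifferentiableAt ℝ (deriv p.S0) x
  diff_S1 : ∀ x ∈ U, DifferentiableAt ℝ p.S1 x
  eikonal : ∀ x ∈ U, deriv p.S0 x ^ 2 = ((En - m x ^ 2 : ℝ) : ℂ)
  transport : ∀ x ∈ U,
    2 * deriv p.S0 x * deriv p.S1 x - Complex.I * deriv (deriv p.S0) x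
      + ((σ * deriv m x : ℝ) : ℂ) = 0

/-- The inner (Airy) variable `ζ = λ^{1/3} ε^{-2/3} (x - xτ)` at a turning point `xτ`, with
`λ = 2 m(xτ) m'(xτ)` and the real cube root.  One has `ζ < 0` on the allowed side and `ζ > 0` on
the forbidden side. -/
noncomputable def airyVar (m : ℝ → ℝ) (ε xτ x : ℝ) : ℝ :=
  Real.sign (2 * m xτ * deriv m xτ) * |2 * m xτ * deriv m xτ| ^ (1 / 3 : ℝ)
    * ε ^ (-(2 / 3) : ℝ) * (x - xτ)

/-- The leading-order linearisation of a WKB function at the turning point `xτ`, approached within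
`U`, is `c |ζ|^{-1/4} exp (i s (2/3) |ζ|^{3/2})`: the leading phase satisfies
`S₀ = S₀(xτ) + s (2/3) ε |ζ|^{3/2} (1 + o(1))`, the amplitude satisfies
`exp (i S₁) = |ζ|^{-1/4} (b + o(1))`, and `c = exp (i S₀(xτ) / ε) b`.
Here `s = 1` and `s = -1` are the two oscillating waves and `s = i` is the wave that decays away
from the turning point. -/
def WKBPhase.HasOverlapForm (p : WKBPhase) (m : ℝ → ℝ) (ε xτ : ℝ) (U : Set ℝ) (s c : ℂ) : Prop :=
  ∃ a b : ℂ,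
    Tendsto (fun x : ℝ => (p.S0 x - a) / ((ε * |airyVar m ε xτ x| ^ (3 / 2 : ℝ) : ℝ) : ℂ))
      (𝓝[U] xτ) (𝓝 (s * (2 / 3))) ∧
    Tendsto (fun x : ℝ => ((|airyVar m ε xτ x| ^ (1 / 4 : ℝ) : ℝ) : ℂ)
      * Complex.exp (Complex.I * p.S1 x)) (𝓝[U] xτ) (𝓝 b) ∧
    c = Complex.exp (Complex.I * a / ε) * b

/-- Solutions of the Airy equation `φ'' = ζ φ` on the real line. -/
def IsAirySolution (φ : ℝ → ℂ) : Prop :=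
  ∀ ζ : ℝ, DifferentiableAt ℝ φ ζ ∧ HasDerivAt (deriv φ) (ζ * φ ζ) ζ

/-- `φ(ζ) = ζ^{-1/4} exp (-(2/3) ζ^{3/2}) (c + o(1))` as `ζ → +∞`. -/
def HasForbiddenForm (φ : ℝ → ℂ) (c : ℂ) : Prop :=
  Tendsto (fun ζ : ℝ =>
    ((ζ ^ (1 / 4 : ℝ) * Real.exp (2 / 3 * ζ ^ (3 / 2 : ℝ)) : ℝ) : ℂ) * φ ζ) atTop (𝓝 c)

/-- `φ(ζ) = |ζ|^{-1/4} (c₊ exp (i (2/3) |ζ|^{3/2}) + c₋ exp (-i (2/3) |ζ|^{3/2}) + o(1))`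
as `ζ → -∞`. -/
def HasAllowedForm (φ : ℝ → ℂ) (cplus cminus : ℂ) : Prop :=
  Tendsto (fun ζ : ℝ => ((|ζ| ^ (1 / 4 : ℝ) : ℝ) : ℂ) * φ ζ
    - (cplus * Complex.exp (Complex.I * ((2 / 3 * |ζ| ^ (3 / 2 : ℝ) : ℝ) : ℂ))
      + cminus * Complex.exp (-(Complex.I * ((2 / 3 * |ζ| ^ (3 / 2 : ℝ) : ℝ) : ℂ)))))
    atBot (𝓝 0)

/-- Airy matching through the turning point `xτ`, with relative error at most `η`.
`f` is a WKB phase on the forbidden side `F`; `out` and `inc` are the WKB phases on the allowed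
side `A` that travel away from and towards `xτ`.  One solution `φ` of the Airy equation has, as
`ζ → +∞`, the linearised form of the forbidden WKB function and, as `ζ → -∞`, the linearised form
of the superposition of the two allowed WKB functions, the coefficients of
`exp (± i (2/3) |ζ|^{3/2})` being equal up to the relative error `η`. -/
def MatchedThrough (m : ℝ → ℝ) (ε xτ η : ℝ) (F A : Set ℝ) (f out inc : WKBPhase) : Prop :=
  ∃ (φ : ℝ → ℂ) (c cplus cminus dplus dminus : ℂ),
    IsAirySolution φ ∧ HasForbiddenForm φ c ∧ HasAllowedForm φ cplus cminus ∧
    f.HasOverlapForm m ε xτ F Complex.I c ∧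
    out.HasOverlapForm m ε xτ A 1 dplus ∧
    inc.HasOverlapForm m ε xτ A (-1) dminus ∧
    ‖dplus - cplus‖ ≤ η * ‖cplus‖ ∧ ‖dminus - cminus‖ ≤ η * ‖cminus‖

/-- Global consistency, with relative error at most `η`, of the WKB solution of
`-ε² ψ'' + (m² + σ ε m') ψ = En ψ`: there are WKB functions `l`, decaying at `-∞`, on the left
forbidden region, `R + L` (a right-moving and a left-moving wave) on the allowed region, and `r`,
decaying at `+∞`, on the right forbidden region, that are matched through both turning points by
Airy asymptotics. -/
def GloballyConsistent (m : ℝ → ℝ) (σ : ℤ) (ε En xm xp η : ℝ) : Prop :=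
  ∃ l R L r : WKBPhase,
    l.Solves m σ En (Set.Iio xm) ∧ Tendsto (l.mode ε) atBot (𝓝 0) ∧
    r.Solves m σ En (Set.Ioi xp) ∧ Tendsto (r.mode ε) atTop (𝓝 0) ∧
    R.Solves m σ En (Set.Ioo xm xp) ∧ (∀ x ∈ Set.Ioo xm xp, 0 < (deriv R.S0 x).re) ∧
    L.Solves m σ En (Set.Ioo xm xp) ∧ (∀ x ∈ Set.Ioo xm xp, (deriv L.S0 x).re < 0) ∧
    MatchedThrough m ε xm η (Set.Iio xm) (Set.Ioo xm xp) l R L ∧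
    MatchedThrough m ε xp η (Set.Ioi xp) (Set.Ioo xm xp) r L R

/-- The accumulated phase `Φ = (1/ε) ∫_{x₋}^{x₊} √(En - m²) dx`. -/
noncomputable def accumulatedPhase (m : ℝ → ℝ) (ε En xm xp : ℝ) : ℝ :=
  (1 / ε) * ∫ x in xm..xp, Real.sqrt (En - m x ^ 2)

/-! On the allowed interval put P = √(En - m²), and let Φ be the accumulated phase. The phase
equations integrate in closed form: S₀' = τP with τ = ±1, and exp(i S₁) is a constant times |En -
m²|^(-1/4) exp(-iστθ/2), where θ' = m'/P. Here θ = arcsin(m/√En) climbs from -π/2 at the left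
turning point to π/2 at the right one. So between the two turning points a wave picks up exp(iτΦ)
from S₀ and exp(-iστπ/2) from S₁ (`AreTurningPoints.exists_allowed`,
`AreTurningPoints.allowed_coeffs`).

At a turning point, an Airy solution recessive on the forbidden side is a multiple of Airy's
function, and its two oscillating coefficients have ratio c₊/c₋ = exp(-iπ/2)
(`IsAirySolution.connection`). Existence and asymptotics of Airy's function come from its contour
integral: a saddle point computation on rays, and a three-term relation that transfers it to the
negative axis.

Multiplying the ratio conditions at the two turning points cancels all free amplitudes and leaves u⁴
exp(-2iΦ) = (-i)² = -1 with u = exp(iσπ/4). Since u⁴ = -1 for both signs of σ, the transport phase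
cancels the usual half-integer shift and the condition is exp(2iΦ) = 1, that is, Φ ∈ πℤ. The sign σ
only decides how the integers are labelled.

Relative errors η in the four coefficients give |exp(2iΦ) - 1| ≤ 6η
(`GloballyConsistent.norm_exp_sub_one_le`). Conversely, free constants make three of the four
coefficients exact, and the fourth has relative error |exp(2iΦ) - 1|
(`globallyConsistent_of_norm_exp_sub_one_le`). The decaying waves exist with any nonzero
coefficient, so they impose nothing. Finally ∫P is bounded below uniformly for En ≥ a, so Φ is large
for small ε and the integer found is positive, which yields k ≥ 0. -/

open MeasureTheory Complex

/-! ### Airy's integral over horizontal lines -/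

/-- The integrand of Airy's integral. -/
noncomputable def airyKernel (x t : ℂ) : ℂ := cexp (I * (t ^ 3 / 3 + x * t))

/-- The integrals of `(I t) ^ k exp (I (t ^ 3 / 3 + x t))` over the line `Im t = 1`. -/
noncomputable def airyMoment (k : ℕ) (x : ℂ) : ℂ :=
  ∫ s : ℝ, (I * (s + I)) ^ k * airyKernel x (s + I)

/-- Completing the square absorbs the linear term into half of the Gaussian. These functions are the
majorants for differentiation under the integral sign. -/
lemma integrable_exp_neg_sq_add_abs {δ : ℝ} (hδ : 0 < δ) (B : ℝ) :
    Integrable fun s : ℝ => Real.exp (-δ * s ^ 2 + B * (1 + |s|)) := by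
  refine Integrable.mono' ((integrable_exp_neg_mul_sq (half_pos hδ)).const_mul
    (Real.exp (B + B ^ 2 / (2 * δ)))) (by fun_prop) (Eventually.of_forall fun s => ?_)
  rw [Real.norm_of_nonneg (Real.exp_pos _).le, ← Real.exp_add, Real.exp_le_exp]
  have h : 0 ≤ (δ * |s| - B) ^ 2 / (2 * δ) := by positivity
  have h2 : (δ * |s| - B) ^ 2 / (2 * δ) = δ / 2 * s ^ 2 - B * |s| + B ^ 2 / (2 * δ) := by
    rw [← sq_abs s]; field_simp; ring
  linarith

/-- On the line Im t = η the real part of i t³/3 is -η s² + η³/3, whence Gaussian decay. Only bounds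
δ and B enter on the right, so that one majorant serves a whole neighbourhood of x or of η. -/
lemma norm_airyKernel_le {x : ℂ} {δ η B : ℝ} (hδ : δ ≤ η) (hη : 0 < η)
    (hB : η ^ 3 + (η + 1) * ‖x‖ ≤ B) (s : ℝ) :
    ‖airyKernel x (s + η * I)‖ ≤ Real.exp (-δ * s ^ 2 + B * (1 + |s|)) := by
  rw [airyKernel, norm_exp, Real.exp_le_exp]
  have h : (I * ((s + η * I) ^ 3 / 3 + x * (s + η * I))).re
      = -η * s ^ 2 + η ^ 3 / 3 - η * x.re - s * x.im := by
    have : (s + η * I : ℂ) ^ 3 = (s ^ 3 - 3 * s * η ^ 2 : ℝ) + (3 * s ^ 2 * η - η ^ 3 : ℝ) * I := by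
      push_cast
      linear_combination (3 * s * η ^ 2 + η ^ 3 * I : ℂ) * I_sq
    rw [this, show ((s ^ 3 - 3 * s * η ^ 2 : ℝ) + (3 * s ^ 2 * η - η ^ 3 : ℝ) * I : ℂ) / 3
      = ((s ^ 3 - 3 * s * η ^ 2) / 3 : ℝ) + ((3 * s ^ 2 * η - η ^ 3) / 3 : ℝ) * I by
        push_cast; ring]
    simp only [mul_re, mul_im, add_re, add_im, I_re, I_im, ofReal_re, ofReal_im]
    ring
  rw [h]
  have h1 : -(η * x.re) ≤ η * ‖x‖ := by
    have := (abs_le.1 (abs_re_le_norm x)).1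
    nlinarith
  have h2 : -(s * x.im) ≤ |s| * ‖x‖ := by
    calc -(s * x.im) ≤ |s * x.im| := neg_le_abs _
      _ = |s| * |x.im| := abs_mul _ _
      _ ≤ _ := by gcongr; exact abs_im_le_norm x
  have h3 : δ * s ^ 2 ≤ η * s ^ 2 := by gcongr
  have h4 : ‖x‖ * |s| ≤ B * |s| := by
    gcongr
    have : 0 ≤ η ^ 3 := by positivity
    nlinarith [norm_nonneg x]
  have h5 : 0 ≤ η ^ 3 := by positivity
  nlinarith [norm_nonneg x]

lemma norm_pow_mul_airyKernel_le (k : ℕ) {x : ℂ} {δ η B : ℝ} (hδ : δ ≤ η) (hη : 0 < η)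
    (hB : η ^ 3 + (η + 1) * ‖x‖ ≤ B) (s : ℝ) :
    ‖(I * (s + η * I)) ^ k * airyKernel x (s + η * I)‖
      ≤ Real.exp (-δ * s ^ 2 + (B + k * (1 + η)) * (1 + |s|)) := by
  rw [norm_mul, norm_pow, norm_mul, norm_I, one_mul]
  have h1 : ‖(s + η * I : ℂ)‖ ≤ Real.exp ((1 + η) * (1 + |s|)) := by
    calc ‖(s + η * I : ℂ)‖ ≤ |s| + η := by
          refine (norm_add_le _ _).trans ?_
          simp [abs_of_pos hη]
      _ ≤ (1 + η) * (1 + |s|) + 1 := by nlinarith [abs_nonneg s, mul_nonneg hη.le (abs_nonneg s)]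
      _ ≤ _ := Real.add_one_le_exp _
  calc _ ≤ Real.exp ((1 + η) * (1 + |s|)) ^ k * Real.exp (-δ * s ^ 2 + B * (1 + |s|)) := by
        gcongr
        exact norm_airyKernel_le hδ hη hB s
    _ = _ := by
        rw [← Real.exp_nat_mul, ← Real.exp_add]
        congr 1
        ring

lemma continuous_airyKernel_line (x : ℂ) (η : ℝ) :
    Continuous fun s : ℝ => airyKernel x (s + η * I) := by
  unfold airyKernel
  fun_prop

lemma hasDerivAt_airyKernel_left (x t : ℂ) :
    HasDerivAt (fun x => airyKernel x t) (I * t * airyKernel x t) x := by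
  have h : HasDerivAt (fun x : ℂ => I * (t ^ 3 / 3 + x * t)) (I * t) x := by
    simpa using (((hasDerivAt_id x).mul_const t).const_add (t ^ 3 / 3)).const_mul I
  simpa [airyKernel, mul_comm] using h.cexp

lemma hasDerivAt_airyKernel_right (x t : ℂ) :
    HasDerivAt (fun t => airyKernel x t) (I * (t ^ 2 + x) * airyKernel x t) t := by
  have h : HasDerivAt (fun t : ℂ => I * (t ^ 3 / 3 + x * t)) (I * (t ^ 2 + x)) t := by
    refine ((((hasDerivAt_pow 3 t).div_const 3).add
      ((hasDerivAt_id t).const_mul x)).const_mul I).congr_deriv ?_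
    norm_num
  simpa [airyKernel, mul_comm] using h.cexp

lemma integrable_pow_mul_airyKernel (k : ℕ) (x : ℂ) {η : ℝ} (hη : 0 < η) :
    Integrable fun s : ℝ => (I * (s + η * I)) ^ k * airyKernel x (s + η * I) := by
  have := continuous_airyKernel_line x η
  exact (integrable_exp_neg_sq_add_abs hη _).mono' (by fun_prop)
    (Eventually.of_forall fun s => norm_pow_mul_airyKernel_le k le_rfl hη le_rfl s)

lemma hasDerivAt_airyMoment (k : ℕ) (x : ℂ) :
    HasDerivAt (airyMoment k) (airyMoment (k + 1) x) x := by
  have hc (y : ℂ) : Continuous fun s : ℝ => airyKernel y (s + I) := by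
    simpa using continuous_airyKernel_line y 1
  refine (hasDerivAt_integral_of_dominated_loc_of_deriv_le (Metric.ball_mem_nhds x one_pos)
    (F' := fun y (s : ℝ) => (I * (s + I)) ^ (k + 1) * airyKernel y (s + I))
    (bound := fun s => Real.exp (-1 * s ^ 2
      + ((1 + 2 * (‖x‖ + 1)) + (k + 1 : ℕ) * (1 + 1)) * (1 + |s|)))
    (Eventually.of_forall fun y => ?_) ?_ ?_ (Eventually.of_forall fun s y hy => ?_)
    (integrable_exp_neg_sq_add_abs one_pos _) (Eventually.of_forall fun s y hy => ?_)).2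
  · have := hc y
    fun_prop
  · simpa using integrable_pow_mul_airyKernel k x one_pos
  · have := hc x
    fun_prop
  · have hy' : ‖y‖ ≤ ‖x‖ + 1 := by
      have h1 := norm_sub_norm_le y x
      have h2 := mem_ball_iff_norm.1 hy
      linarith
    simpa using norm_pow_mul_airyKernel_le (k + 1) (x := y) (le_refl 1) one_pos
      (B := 1 + 2 * (‖x‖ + 1)) (by norm_num; linarith) s
  · exact ((hasDerivAt_airyKernel_left y (s + I)).const_mul ((I * (s + I)) ^ k)).congr_deriv
      (by ring)

/-- The integrand is the s-derivative of an integrable function. This identity yields both Airy's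
equation and the independence of the contour. -/
lemma integral_deriv_airyKernel (x : ℂ) {η : ℝ} (hη : 0 < η) :
    ∫ s : ℝ, I * ((s + η * I) ^ 2 + x) * airyKernel x (s + η * I) = 0 := by
  refine integral_eq_zero_of_hasDerivAt_of_integrable
    (f := fun s : ℝ => airyKernel x (s + η * I)) (fun s => ?_) ?_ ?_
  · have h : HasDerivAt (fun z : ℂ => z + η * I) 1 (s : ℂ) := (hasDerivAt_id _).add_const _
    simpa using ((hasDerivAt_airyKernel_right x (s + η * I)).comp (s : ℂ) h).comp_ofReal
  · have h0 := (integrable_pow_mul_airyKernel 0 x hη).const_mul (I * x)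
    have h2 := (integrable_pow_mul_airyKernel 2 x hη).const_mul (-I)
    refine (h0.add h2).congr (Eventually.of_forall fun s => ?_)
    simp only [Pi.add_apply, mul_pow, I_sq]
    ring
  · simpa using integrable_pow_mul_airyKernel 0 x hη

/-- This is Airy's equation for `airyMoment 0`, because differentiation in x raises the index by
one; it follows from (I t)² = -t² and the vanishing integral of a derivative. -/
lemma airyMoment_two (x : ℂ) : airyMoment 2 x = x * airyMoment 0 x := by
  have h := integral_deriv_airyKernel x one_pos
  have h0 := integrable_pow_mul_airyKernel 0 x one_pos
  have h2 := integrable_pow_mul_airyKernel 2 x one_pos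
  simp only [ofReal_one, one_mul] at h h0 h2
  have e : (fun s : ℝ => I * ((s + I) ^ 2 + x) * airyKernel x (s + I))
      = fun s : ℝ => I * x * ((I * (s + I)) ^ 0 * airyKernel x (s + I))
        - I * ((I * (s + I)) ^ 2 * airyKernel x (s + I)) := by
    ext s
    simp only [mul_pow, I_sq]
    ring
  rw [e, integral_sub (h0.const_mul _) (h2.const_mul _), integral_const_mul,
    integral_const_mul] at h
  change I * x * airyMoment 0 x - I * airyMoment 2 x = 0 at h
  have : I * (airyMoment 2 x - x * airyMoment 0 x) = 0 := by linear_combination -h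
  exact sub_eq_zero.1 ((mul_eq_zero.1 this).resolve_left I_ne_zero)

/-- Airy's integral may be taken over any horizontal line in the upper half plane. -/
lemma integral_airyKernel_line (x : ℂ) {η : ℝ} (hη : 0 < η) :
    ∫ s : ℝ, airyKernel x (s + η * I) = airyMoment 0 x := by
  -- By holomorphy the η-derivative of the kernel is I times its s-derivative, whose integral
  -- vanishes; this replaces Cauchy's theorem.
  have key : ∀ η > 0, HasDerivAt (fun η : ℝ => ∫ s : ℝ, airyKernel x (s + η * I)) 0 η := by
    intro η hη
    have h := hasDerivAt_integral_of_dominated_loc_of_deriv_le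
      (Ioo_mem_nhds (half_lt_self hη) (lt_two_mul_self hη))
      (F := fun (y : ℝ) (s : ℝ) => airyKernel x (s + y * I))
      (F' := fun (y : ℝ) (s : ℝ) => I * (I * ((s + y * I) ^ 2 + x) * airyKernel x (s + y * I)))
      (μ := volume) (x₀ := η)
      (bound := fun s => Real.exp (-(η / 2) * s ^ 2
        + (((2 * η) ^ 3 + (2 * η + 1) * ‖x‖) + (2 : ℕ) * (1 + 2 * η)) * (1 + |s|))
        + ‖x‖ * Real.exp (-(η / 2) * s ^ 2
          + ((2 * η) ^ 3 + (2 * η + 1) * ‖x‖) * (1 + |s|)))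
      (Eventually.of_forall fun y => ?_) ?_ ?_ (Eventually.of_forall fun s y hy => ?_)
      ?_ (Eventually.of_forall fun s y hy => ?_)
    · have h2 := h.2
      rwa [integral_const_mul, integral_deriv_airyKernel x hη, mul_zero] at h2
    · exact (continuous_airyKernel_line x y).aestronglyMeasurable
    · simpa using integrable_pow_mul_airyKernel 0 x hη
    · have := continuous_airyKernel_line x η
      fun_prop
    · have hy0 : 0 < y := by linarith [hy.1]
      have hB : y ^ 3 + (y + 1) * ‖x‖ ≤ (2 * η) ^ 3 + (2 * η + 1) * ‖x‖ := by
        have := hy.2.le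
        gcongr
      have e : I * (I * ((s + y * I) ^ 2 + x) * airyKernel x (s + y * I))
          = (I * (s + y * I)) ^ 2 * airyKernel x (s + y * I)
            + -x * airyKernel x (s + y * I) := by
        simp only [mul_pow]
        linear_combination (x * airyKernel x (s + y * I)) * I_sq
      rw [e]
      refine (norm_add_le _ _).trans (add_le_add ?_ ?_)
      · refine (norm_pow_mul_airyKernel_le 2 hy.1.le hy0 hB s).trans (Real.exp_le_exp.2 ?_)
        have := hy.2.le
        gcongr
      · rw [norm_mul, norm_neg]
        gcongr
        exact norm_airyKernel_le hy.1.le hy0 hB s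
    · exact (integrable_exp_neg_sq_add_abs (half_pos hη) _).add
        ((integrable_exp_neg_sq_add_abs (half_pos hη) _).const_mul _)
    · have h : HasDerivAt (fun z : ℂ => (s : ℂ) + z * I) I (y : ℂ) := by
        simpa using ((hasDerivAt_id (y : ℂ)).mul_const I).const_add (s : ℂ)
      exact ((hasDerivAt_airyKernel_right x (s + y * I)).comp (y : ℂ) h).comp_ofReal.congr_deriv
        (mul_comm _ _)
  have hconst := (convex_Ioi (0 : ℝ)).is_const_of_fderivWithin_eq_zero
    (f := fun η : ℝ => ∫ s : ℝ, airyKernel x (s + η * I)) (𝕜 := ℝ)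
    (fun y hy => (key y hy).differentiableAt.differentiableWithinAt)
    (fun y hy => by
      rw [fderivWithin_of_isOpen isOpen_Ioi hy]
      have := (key y hy).hasFDerivAt.fderiv
      rw [this]; ext; simp) hη (Set.mem_Ioi.2 one_pos)
  simpa [airyMoment] using hconst

/-! ### Saddle point asymptotics of Airy's integral -/

/-- The phase t³/3 + w² t has a saddle at t = I w. Taking the line of height `w.re` and translating
s by `w.im` gives t = s + I w, where the expansion about the saddle is exact. -/
lemma airyMoment_zero_sq {w : ℂ} (hw : 0 < w.re) :
    airyMoment 0 (w ^ 2)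
      = cexp (-(2 / 3) * w ^ 3) * ∫ s : ℝ, cexp (-w * s ^ 2 + I * s ^ 3 / 3) := by
  rw [← integral_airyKernel_line (w ^ 2) hw, ← integral_const_mul,
    ← integral_sub_right_eq_self _ w.im]
  congr 1 with s
  rw [airyKernel, ← Complex.exp_add]
  congr 1
  have h : ((s - w.im : ℝ) : ℂ) + w.re * I = s + I * w := by
    conv_rhs => rw [← re_add_im w]
    push_cast
    linear_combination (-w.im : ℂ) * I_sq
  rw [h]
  linear_combination (s ^ 2 * w + I * s * w ^ 2 + w ^ 3 / 3 * (I ^ 2 - 1) + w ^ 3) * I_sq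

lemma integral_cubic_exp_smul {r : ℝ} (hr : 0 < r) (v : ℂ) :
    ∫ s : ℝ, cexp (-(r * v) * s ^ 2 + I * s ^ 3 / 3)
      = (√r : ℂ)⁻¹ * ∫ u : ℝ, cexp (-v * u ^ 2 + I * (u / √r : ℝ) ^ 3 / 3) := by
  have hs : 0 < √r := Real.sqrt_pos.2 hr
  have h := Measure.integral_comp_mul_left
    (fun u : ℝ => cexp (-v * u ^ 2 + I * (u / √r : ℝ) ^ 3 / 3)) √r
  rw [abs_of_pos (inv_pos.2 hs), real_smul] at h
  rw [← ofReal_inv, ← h]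
  congr 1 with s
  congr 2
  · have : (√r : ℂ) ^ 2 = r := by rw [← ofReal_pow, Real.sq_sqrt hr.le]
    push_cast
    rw [mul_pow, this]; ring
  · rw [mul_div_cancel_left₀ _ hs.ne']

/-- The cubic term is purely imaginary, so the Gaussian dominates uniformly in r, and pointwise the
cubic term disappears in the limit. -/
lemma tendsto_integral_cubic_exp {v : ℂ} (hv : 0 < v.re) :
    Tendsto (fun r : ℝ => ∫ u : ℝ, cexp (-v * u ^ 2 + I * (u / √r : ℝ) ^ 3 / 3)) atTop
      (𝓝 ((Real.pi / v) ^ (1 / 2 : ℂ))) := by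
  rw [← integral_gaussian_complex hv]
  refine tendsto_integral_filter_of_dominated_convergence
    (fun u => Real.exp (-v.re * u ^ 2)) (Eventually.of_forall fun r => ?_)
    (Eventually.of_forall fun r => Eventually.of_forall fun u => ?_)
    (integrable_exp_neg_mul_sq hv) (Eventually.of_forall fun u => ?_)
  · exact Continuous.aestronglyMeasurable (by fun_prop)
  · rw [norm_exp, Real.exp_le_exp]
    have h1 : (-v * (u : ℂ) ^ 2).re = -v.re * u ^ 2 := by
      rw [← ofReal_pow, re_mul_ofReal, neg_re]
    have h2 : (I * ((u / √r : ℝ) : ℂ) ^ 3 / 3).re = 0 := by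
      rw [← ofReal_pow, mul_div_assoc, show ((((u / √r) ^ 3 : ℝ) : ℂ) / 3)
        = (((u / √r) ^ 3 / 3 : ℝ) : ℂ) by push_cast; ring, re_mul_ofReal, I_re, zero_mul]
    rw [add_re, h1, h2, add_zero]
  · have h0 : Tendsto (fun r : ℝ => u / √r) atTop (𝓝 0) :=
      tendsto_const_nhds.div_atTop Real.tendsto_sqrt_atTop
    have h1 : Continuous fun y : ℝ => cexp (-v * u ^ 2 + I * (y : ℂ) ^ 3 / 3) := by fun_prop
    have h2 := (h1.tendsto 0).comp h0
    simp only [ofReal_zero, ne_eq, OfNat.ofNat_ne_zero, not_false_eq_true, zero_pow, mul_zero,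
      zero_div, add_zero] at h2
    exact h2

/-- The asymptotics of Airy's integral along the ray through `v ^ 2`. -/
lemma tendsto_airyMoment_ray {v : ℂ} (hv : 0 < v.re) :
    Tendsto (fun r : ℝ => (√r : ℂ) * cexp (2 / 3 * (r * v) ^ 3) * airyMoment 0 ((r * v) ^ 2))
      atTop (𝓝 ((Real.pi / v) ^ (1 / 2 : ℂ))) := by
  refine (tendsto_integral_cubic_exp hv).congr' ?_
  filter_upwards [eventually_gt_atTop 0] with r hr
  have hs : (√r : ℂ) ≠ 0 := ofReal_ne_zero.2 (Real.sqrt_pos.2 hr).ne'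
  rw [airyMoment_zero_sq (by rw [re_ofReal_mul]; positivity), integral_cubic_exp_smul hr]
  have he : cexp (2 / 3 * (r * v) ^ 3) * cexp (-(2 / 3) * (r * v) ^ 3) = 1 := by
    rw [← Complex.exp_add, ← Complex.exp_zero]; congr 1; ring
  generalize cexp (2 / 3 * (r * v) ^ 3) = E at he ⊢
  generalize cexp (-(2 / 3) * (r * v) ^ 3) = E' at he ⊢
  generalize ∫ u : ℝ, cexp (-v * u ^ 2 + I * (u / √r : ℝ) ^ 3 / 3) = J
  linear_combination -(E * E' * J) * mul_inv_cancel₀ hs - J * he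

lemma pi_div_exp_cpow {θ : ℝ} (h1 : -Real.pi < θ) (h2 : θ ≤ Real.pi) :
    (Real.pi / cexp (-(θ * I))) ^ (1 / 2 : ℂ) = √Real.pi * cexp (θ / 2 * I) := by
  have hpi : (Real.pi : ℂ) = cexp (Real.log Real.pi) := by
    rw [← ofReal_exp, Real.exp_log Real.pi_pos]
  have h : (Real.pi / cexp (-(θ * I)) : ℂ) = cexp (Real.log Real.pi + θ * I) := by
    rw [Complex.exp_add, ← hpi, Complex.exp_neg, div_inv_eq_mul]
  rw [h, cpow_def_of_ne_zero (exp_ne_zero _), log_exp (by simpa using h1) (by simpa using h2),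
    add_mul, Complex.exp_add, Real.sqrt_eq_rpow, ofReal_cpow Real.pi_pos.le,
    cpow_def_of_ne_zero (by exact_mod_cast Real.pi_ne_zero), ← ofReal_log Real.pi_pos.le]
  push_cast
  congr 2
  ring

/-! ### Airy's equation: uniqueness, rotated solutions, recessive solutions -/

lemma IsAirySolution.of_hasDerivAt {φ φ' : ℝ → ℂ} (h : ∀ ζ, HasDerivAt φ (φ' ζ) ζ)
    (h' : ∀ ζ : ℝ, HasDerivAt φ' (ζ * φ ζ) ζ) : IsAirySolution φ := by
  have : deriv φ = φ' := funext fun ζ => (h ζ).deriv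
  exact fun ζ => ⟨(h ζ).differentiableAt, this ▸ h' ζ⟩

lemma IsAirySolution.const_mul {φ : ℝ → ℂ} (h : IsAirySolution φ) (t : ℂ) :
    IsAirySolution fun ζ => t * φ ζ :=
  .of_hasDerivAt (fun ζ => (h ζ).1.hasDerivAt.const_mul t)
    fun ζ => ((h ζ).2.const_mul t).congr_deriv (by ring)

lemma IsAirySolution.add {φ ψ : ℝ → ℂ} (h : IsAirySolution φ) (h' : IsAirySolution ψ) :
    IsAirySolution fun ζ => φ ζ + ψ ζ :=
  .of_hasDerivAt (fun ζ => (h ζ).1.hasDerivAt.add (h' ζ).1.hasDerivAt)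
    fun ζ => ((h ζ).2.add (h' ζ).2).congr_deriv (by ring)

lemma IsAirySolution.eq_zero {φ : ℝ → ℂ} (h : IsAirySolution φ) (h0 : φ 0 = 0)
    (h1 : deriv φ 0 = 0) (ζ : ℝ) : φ ζ = 0 := by
  set b : ℝ := |ζ| + 1
  have hb : 0 < b := by positivity
  have key : Set.EqOn (fun t => (φ t, deriv φ t)) (fun _ => (0, 0)) (Set.Ioo (-b) b) := by
    refine ODE_solution_unique_of_mem_Ioo (v := fun (t : ℝ) (p : ℂ × ℂ) => (p.2, t * p.1))
      (s := fun _ => Set.univ) (K := ⟨b + 1, by positivity⟩) (t₀ := 0) (fun t ht => ?_)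
      ⟨by linarith, hb⟩ (fun t _ => ⟨(h t).1.hasDerivAt.prodMk (h t).2, trivial⟩)
      (fun t _ => ⟨by simpa [Prod.zero_eq_mk] using hasDerivAt_const t (0 : ℂ × ℂ), trivial⟩) (by simp [h0, h1])
    refine LipschitzOnWith.of_dist_le_mul fun p _ q _ => ?_
    have hp1 : dist p.1 q.1 ≤ dist p q := le_max_left _ _
    have hp2 : dist p.2 q.2 ≤ dist p q := le_max_right _ _
    have ht' : |t| ≤ b := abs_le.2 ⟨ht.1.le, ht.2.le⟩
    change dist _ _ ≤ (b + 1) * dist p q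
    rw [Prod.dist_eq]
    refine max_le (by dsimp only; nlinarith [dist_nonneg (x := p) (y := q)]) ?_
    have : dist ((t : ℂ) * p.1) (t * q.1) = |t| * dist p.1 q.1 := by
      rw [dist_eq_norm, ← mul_sub, norm_mul, dist_eq_norm, norm_real, Real.norm_eq_abs]
    dsimp only
    rw [this]
    nlinarith [abs_nonneg t, dist_nonneg (x := p) (y := q), dist_nonneg (x := p.1) (y := q.1)]
  have := key (show ζ ∈ Set.Ioo (-b) b from abs_lt.1 (lt_add_one _))
  exact (Prod.mk.inj this).1

/-- A positive multiple of Airy's function `Ai`. -/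
noncomputable def airySol (ζ : ℝ) : ℂ := airyMoment 0 ζ

lemma isAirySolution_airyMoment_mul {c : ℂ} (hc : c ^ 3 = 1) :
    IsAirySolution fun ζ => c * airyMoment 0 (c * ζ) := by
  have hd (k : ℕ) (ζ : ℝ) : HasDerivAt (fun ζ : ℝ => airyMoment k (c * ζ))
      (c * airyMoment (k + 1) (c * ζ)) ζ := by
    have h : HasDerivAt (fun z : ℂ => c * z) c (ζ : ℂ) := by
      simpa using (hasDerivAt_id (ζ : ℂ)).const_mul c
    exact ((hasDerivAt_airyMoment k (c * ζ)).comp (ζ : ℂ) h).comp_ofReal.congr_deriv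
      (mul_comm _ _)
  refine .of_hasDerivAt (φ' := fun ζ => c * (c * airyMoment 1 (c * ζ)))
    (fun ζ => (hd 0 ζ).const_mul c) fun ζ =>
      (((hd 1 ζ).const_mul c).const_mul c).congr_deriv ?_
  change c * (c * (c * airyMoment 2 (c * ζ))) = _
  rw [airyMoment_two]
  linear_combination (c * ζ * airyMoment 0 (c * ζ)) * hc

lemma isAirySolution_airySol : IsAirySolution airySol := by
  have := isAirySolution_airyMoment_mul (c := 1) (by norm_num)
  simp only [one_mul] at this
  exact this

/-- The sum solves Airy's equation, and both its value and its derivative at 0 contain the factor 1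
+ c + c². It expresses Airy's function on the negative axis by its values on two rays that the
saddle point asymptotics reach. -/
lemma airyMoment_add_add_eq_zero {c : ℂ} (hc : c ^ 2 + c + 1 = 0) (ζ : ℝ) :
    airyMoment 0 ζ + c * airyMoment 0 (c * ζ) + c ^ 2 * airyMoment 0 (c ^ 2 * ζ) = 0 := by
  have h3 : c ^ 3 = 1 := by linear_combination (c - 1) * hc
  have h6 : (c ^ 2) ^ 3 = 1 := by rw [← pow_mul, mul_comm, pow_mul, h3, one_pow]
  have hd (b : ℂ) : HasDerivAt (fun ζ : ℝ => b * airyMoment 0 (b * ζ))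
      (b * (b * airyMoment 1 0)) 0 := by
    have h : HasDerivAt (fun z : ℂ => b * z) b ((0 : ℝ) : ℂ) := by
      simpa using (hasDerivAt_id ((0 : ℝ) : ℂ)).const_mul b
    have := (((hasDerivAt_airyMoment 0 (b * (0 : ℝ))).comp ((0 : ℝ) : ℂ) h).comp_ofReal).const_mul b
    exact this.congr_deriv (by simp [mul_comm])
  refine ((isAirySolution_airySol.add (isAirySolution_airyMoment_mul h3)).add
    (isAirySolution_airyMoment_mul h6)).eq_zero ?_ ?_ ζ
  · simp only [airySol, ofReal_zero, mul_zero]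
    linear_combination (airyMoment 0 0) * hc
  · have h1 := hd 1
    simp only [one_mul] at h1
    refine ((h1.add (hd c)).add (hd (c ^ 2))).deriv.trans ?_
    linear_combination (airyMoment 1 0) * (c ^ 2 - c + 1) * hc

/-- With g = Re φ, the function g² has second derivative 2(g'² + t g²) ≥ 0 for t ≥ 0 and slope 2 at
0, so it never falls below its initial value 1. -/
lemma IsAirySolution.not_tendsto_zero {φ : ℝ → ℂ} (h : IsAirySolution φ) (h0 : φ 0 = 1)
    (h1 : deriv φ 0 = 1) : ¬ Tendsto φ atTop (𝓝 0) := by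
  intro hlim
  have hg (t : ℝ) : HasDerivAt (fun t => (φ t).re) (deriv φ t).re t :=
    reCLM.hasFDerivAt.comp_hasDerivAt t (h t).1.hasDerivAt
  have hg' (t : ℝ) : HasDerivAt (fun t => (deriv φ t).re) (t * (φ t).re) t := by
    have := reCLM.hasFDerivAt.comp_hasDerivAt t (h t).2
    rwa [reCLM_apply, re_ofReal_mul] at this
  have hu (t : ℝ) : HasDerivAt (fun t => (φ t).re * (φ t).re)
      (2 * ((φ t).re * (deriv φ t).re)) t := ((hg t).mul (hg t)).congr_deriv (by ring)
  have hu' (t : ℝ) : HasDerivAt (fun t => 2 * ((φ t).re * (deriv φ t).re))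
      (2 * ((deriv φ t).re ^ 2 + t * (φ t).re ^ 2)) t :=
    (((hg t).mul (hg' t)).const_mul 2).congr_deriv (by ring)
  have mono' : MonotoneOn (fun t => 2 * ((φ t).re * (deriv φ t).re)) (Set.Ici 0) := by
    refine monotoneOn_of_deriv_nonneg (convex_Ici 0)
      (fun t _ => (hu' t).continuousAt.continuousWithinAt)
      (fun t _ => (hu' t).differentiableAt.differentiableWithinAt) fun t ht => ?_
    rw [(hu' t).deriv]
    have : 0 < t := by simpa using ht
    positivity
  have mono : MonotoneOn (fun t => (φ t).re * (φ t).re) (Set.Ici 0) := by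
    refine monotoneOn_of_deriv_nonneg (convex_Ici 0)
      (fun t _ => (hu t).continuousAt.continuousWithinAt)
      (fun t _ => (hu t).differentiableAt.differentiableWithinAt) fun t ht => ?_
    rw [(hu t).deriv]
    have ht : 0 < t := by simpa using ht
    refine le_trans ?_ (mono' Set.self_mem_Ici ht.le ht.le)
    simp [h0, h1]
  have hre : Tendsto (fun t => (φ t).re * (φ t).re) atTop (𝓝 0) := by
    have := (continuous_re.tendsto 0).comp hlim
    simpa using this.mul this
  have : (1 : ℝ) ≤ 0 := ge_of_tendsto hre (by
    filter_upwards [eventually_ge_atTop 0] with t ht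
    simpa [h0] using mono Set.self_mem_Ici ht ht)
  norm_num at this

/-- The solutions of Airy's equation that vanish at `+∞` form a line. -/
lemma IsAirySolution.exists_eq_mul {φ ψ : ℝ → ℂ} (hφ : IsAirySolution φ) (hψ : IsAirySolution ψ)
    (hφ0 : Tendsto φ atTop (𝓝 0)) (hψ0 : Tendsto ψ atTop (𝓝 0)) (hne : ∃ ζ, ψ ζ ≠ 0) :
    ∃ t : ℂ, ∀ ζ, φ ζ = t * ψ ζ := by
  have hderiv (α β : ℂ) : deriv (fun ζ => α * φ ζ + β * ψ ζ) 0
      = α * deriv φ 0 + β * deriv ψ 0 :=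
    (((hφ 0).1.hasDerivAt.const_mul α).add ((hψ 0).1.hasDerivAt.const_mul β)).deriv
  have hW : φ 0 * deriv ψ 0 - deriv φ 0 * ψ 0 = 0 := by
    by_contra hW
    set W := φ 0 * deriv ψ 0 - deriv φ 0 * ψ 0 with hWdef
    -- If the Wronskian W were nonzero, this combination would have value and derivative 1 at 0 and
    -- still tend to zero.
    refine ((hφ.const_mul ((deriv ψ 0 - ψ 0) / W)).add
      (hψ.const_mul ((φ 0 - deriv φ 0) / W))).not_tendsto_zero ?_ ?_ ?_
    · field_simp
      rw [hWdef]; ring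
    · rw [hderiv]
      field_simp
      rw [hWdef]; ring
    · simpa using (hφ0.const_mul ((deriv ψ 0 - ψ 0) / W)).add
        (hψ0.const_mul ((φ 0 - deriv φ 0) / W))
  suffices h : ∃ t : ℂ, φ 0 = t * ψ 0 ∧ deriv φ 0 = t * deriv ψ 0 by
    obtain ⟨t, h0, h1⟩ := h
    refine ⟨t, fun ζ => ?_⟩
    have := ((hφ.const_mul 1).add (hψ.const_mul (-t))).eq_zero (by simp [h0])
      (by rw [hderiv, h1]; ring) ζ
    linear_combination this
  by_cases h0 : ψ 0 = 0
  · have h1 : deriv ψ 0 ≠ 0 := by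
      intro h1
      obtain ⟨ζ, hζ⟩ := hne
      exact hζ (hψ.eq_zero h0 h1 ζ)
    refine ⟨deriv φ 0 / deriv ψ 0, ?_, by field_simp⟩
    field_simp
    linear_combination hW
  · refine ⟨φ 0 / ψ 0, by field_simp, ?_⟩
    field_simp
    linear_combination -hW

/-! ### Asymptotic forms on both sides and the connection formula -/

lemma HasForbiddenForm.tendsto_zero {φ : ℝ → ℂ} {c : ℂ} (h : HasForbiddenForm φ c) :
    Tendsto φ atTop (𝓝 0) := by
  have h1 : Tendsto (fun ζ : ℝ => ζ ^ (1 / 4 : ℝ) * Real.exp (2 / 3 * ζ ^ (3 / 2 : ℝ)))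
      atTop atTop := by
    refine (tendsto_rpow_atTop (by norm_num)).atTop_mul_atTop₀ (Real.tendsto_exp_atTop.comp ?_)
    exact (tendsto_rpow_atTop (by norm_num)).const_mul_atTop (by norm_num)
  have h2 := (continuous_ofReal.tendsto 0).comp h1.inv_tendsto_atTop
  rw [ofReal_zero] at h2
  have h3 := h2.mul h
  rw [zero_mul] at h3
  refine h3.congr' ?_
  filter_upwards [h1.eventually_gt_atTop 0] with ζ hζ
  simp only [Function.comp_apply, Pi.inv_apply, ofReal_inv]
  rw [inv_mul_cancel_left₀ (ofReal_ne_zero.2 hζ.ne')]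

lemma sqrt_sqrt_eq_rpow {z : ℝ} (hz : 0 ≤ z) : √(√z) = z ^ (1 / 4 : ℝ) := by
  rw [Real.sqrt_eq_rpow, Real.sqrt_eq_rpow, ← Real.rpow_mul hz]
  norm_num

lemma sqrt_pow_three_eq_rpow {z : ℝ} (hz : 0 ≤ z) : √z ^ 3 = z ^ (3 / 2 : ℝ) := by
  rw [Real.sqrt_eq_rpow, ← Real.rpow_natCast, ← Real.rpow_mul hz]
  norm_num

lemma hasForbiddenForm_airySol : HasForbiddenForm airySol (√Real.pi) := by
  have h := (tendsto_airyMoment_ray (v := 1) (by simp)).comp Real.tendsto_sqrt_atTop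
  have e := pi_div_exp_cpow (θ := 0) (by linarith [Real.pi_pos]) Real.pi_pos.le
  simp only [ofReal_zero, zero_mul, neg_zero, Complex.exp_zero, zero_div, mul_one] at e
  rw [e] at h
  refine h.congr' ?_
  filter_upwards [eventually_gt_atTop 0] with ζ hζ
  have h1 : ((√ζ : ℂ) * 1) ^ 2 = ζ := by rw [mul_one, ← ofReal_pow, Real.sq_sqrt hζ.le]
  have h2 : ((√ζ : ℂ) * 1) ^ 3 = (ζ ^ (3 / 2 : ℝ) : ℝ) := by
    rw [mul_one, ← ofReal_pow, sqrt_pow_three_eq_rpow hζ.le]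
  simp only [Function.comp_apply]
  rw [h1, h2, sqrt_sqrt_eq_rpow hζ.le, airySol]
  push_cast
  rfl

lemma HasForbiddenForm.exists_eq_airySol {φ : ℝ → ℂ} {c : ℂ} (hφ : IsAirySolution φ)
    (h : HasForbiddenForm φ c) : ∃ t : ℂ, ∀ ζ, φ ζ = t * airySol ζ := by
  refine hφ.exists_eq_mul isAirySolution_airySol h.tendsto_zero
    hasForbiddenForm_airySol.tendsto_zero ?_
  by_contra! h0
  have h1 := hasForbiddenForm_airySol
  simp only [HasForbiddenForm, h0, mul_zero] at h1
  have h2 := tendsto_nhds_unique h1 tendsto_const_nhds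
  rw [ofReal_eq_zero] at h2
  exact (Real.sqrt_pos.2 Real.pi_pos).ne' h2

/-- The coefficient of `exp (i (2/3) |ζ|^{3/2})` in `airySol` on the allowed side. -/
noncomputable def airyPlus : ℂ := √Real.pi * cexp (-(Real.pi / 4 * I))

/-- The coefficient of `exp (-i (2/3) |ζ|^{3/2})` in `airySol` on the allowed side. -/
noncomputable def airyMinus : ℂ := √Real.pi * cexp (Real.pi / 4 * I)

/-- When v³ is purely imaginary the exponential factor in the ray asymptotics is unimodular, so
multiplying by it turns the limit of a product into the limit of a difference. -/
lemma tendsto_airyMoment_unit_ray {θ : ℝ} (hre : 0 < (cexp (-(θ * I))).re) (h1 : -Real.pi < θ)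
    (h2 : θ ≤ Real.pi) {κ : ℝ} (hκ : cexp (-(θ * I)) ^ 3 = κ * I) :
    Tendsto (fun z : ℝ => (√(√z) : ℂ) * airyMoment 0 (cexp (-(θ * I)) ^ 2 * z)
      - √Real.pi * cexp (θ / 2 * I) * cexp (-(2 / 3 * κ * (z ^ (3 / 2 : ℝ) : ℝ) * I)))
      atTop (𝓝 0) := by
  have h := ((tendsto_airyMoment_ray hre).comp Real.tendsto_sqrt_atTop).sub_const
    ((Real.pi / cexp (-(θ * I))) ^ (1 / 2 : ℂ))
  rw [sub_self, pi_div_exp_cpow h1 h2] at h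
  refine squeeze_zero_norm' ?_ (tendsto_zero_iff_norm_tendsto_zero.1 h)
  filter_upwards [eventually_gt_atTop 0] with z hz
  have e1 : ((√z : ℂ) * cexp (-(θ * I))) ^ 2 = cexp (-(θ * I)) ^ 2 * z := by
    rw [mul_pow, ← ofReal_pow, Real.sq_sqrt hz.le, mul_comm]
  have e2 : 2 / 3 * ((√z : ℂ) * cexp (-(θ * I))) ^ 3 = 2 / 3 * κ * (z ^ (3 / 2 : ℝ) : ℝ) * I := by
    rw [mul_pow, ← ofReal_pow, sqrt_pow_three_eq_rpow hz.le, hκ]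
    ring
  simp only [Function.comp_apply]
  rw [e1, e2]
  set E := 2 / 3 * (κ : ℂ) * (z ^ (3 / 2 : ℝ) : ℝ) * I with hE
  have hn : ‖cexp E‖ = 1 := by
    rw [hE, show (2 / 3 * (κ : ℂ) * (z ^ (3 / 2 : ℝ) : ℝ)) = (2 / 3 * κ * z ^ (3 / 2 : ℝ) : ℝ) by
      push_cast; rfl]
    exact norm_exp_ofReal_mul_I _
  have hc : cexp E * cexp (-E) = 1 := by rw [← Complex.exp_add, add_neg_cancel, Complex.exp_zero]
  rw [← one_mul ‖_ - _‖, ← hn, ← norm_mul]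
  apply le_of_eq
  congr 1
  linear_combination (-√Real.pi * cexp (θ / 2 * I)) * hc

lemma exp_pi_div_six_mul_I : cexp (Real.pi / 6 * I) = (√3 / 2 : ℝ) + (1 / 2 : ℝ) * I := by
  rw [exp_mul_I, ← ofReal_ofNat, ← ofReal_div, ← ofReal_cos, ← ofReal_sin, Real.cos_pi_div_six,
    Real.sin_pi_div_six]

lemma exp_neg_pi_div_six_mul_I :
    cexp (-(Real.pi / 6 * I)) = (√3 / 2 : ℝ) - (1 / 2 : ℝ) * I := by
  rw [← neg_mul, exp_mul_I, Complex.cos_neg, Complex.sin_neg, ← ofReal_ofNat, ← ofReal_div,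
    ← ofReal_cos, ← ofReal_sin, Real.cos_pi_div_six, Real.sin_pi_div_six]
  ring

/-- For ζ < 0 the three-term relation makes `airySol` the sum of v² A(v² |ζ|) over v = exp(∓iπ/6),
where A is `airyMoment 0`. As v³ = ∓i, each term is one oscillating wave, with phase exp(∓iπ/3 ±
iπ/12) = exp(∓iπ/4). -/
lemma hasAllowedForm_airySol : HasAllowedForm airySol airyPlus airyMinus := by
  have hs3 : (√3 : ℂ) ^ 2 = 3 := by
    rw [← ofReal_pow, Real.sq_sqrt (by norm_num)]; norm_num
  set v₁ := cexp (-(((Real.pi / 6 : ℝ) : ℂ) * I)) with hv₁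
  set v₂ := cexp (-(((-(Real.pi / 6) : ℝ) : ℂ) * I)) with hv₂
  have e₁ : v₁ = (√3 / 2 : ℝ) - (1 / 2 : ℝ) * I := by
    rw [hv₁, ← exp_neg_pi_div_six_mul_I]; push_cast; rfl
  have e₂ : v₂ = (√3 / 2 : ℝ) + (1 / 2 : ℝ) * I := by
    rw [hv₂, ← exp_pi_div_six_mul_I]; push_cast; congr 1; ring
  have f₁ : v₁ ^ 2 = 1 / 2 - √3 / 2 * I := by
    rw [e₁]; push_cast; linear_combination 1 / 4 * hs3 + 1 / 4 * I_sq
  have f₂ : v₂ ^ 2 = 1 / 2 + √3 / 2 * I := by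
    rw [e₂]; push_cast; linear_combination 1 / 4 * hs3 + 1 / 4 * I_sq
  have hpi := Real.pi_pos
  have h₁ := tendsto_airyMoment_unit_ray (θ := Real.pi / 6) (κ := -1)
    (by rw [← hv₁, e₁]; simp) (by linarith) (by linarith) (by
      rw [← hv₁, e₁]; push_cast
      linear_combination (√3 / 8 - 3 / 8 * I) * hs3 + (3 * √3 / 8 - I / 8) * I_sq)
  have h₂ := tendsto_airyMoment_unit_ray (θ := -(Real.pi / 6)) (κ := 1)
    (by rw [← hv₂, e₂]; simp) (by linarith) (by linarith) (by
      rw [← hv₂, e₂]; push_cast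
      linear_combination (√3 / 8 + 3 / 8 * I) * hs3 + (3 * √3 / 8 + I / 8) * I_sq)
  have h := ((h₁.const_mul (v₁ ^ 2)).add (h₂.const_mul (v₂ ^ 2))).comp tendsto_neg_atBot_atTop
  simp only [mul_zero, add_zero] at h
  refine h.congr' ?_
  filter_upwards [eventually_lt_atBot 0] with ζ hζ
  -- Here -v₁² = exp(2πi/3) is a primitive cube root of unity, and for ζ < 0 it sends ζ to v₁² |ζ|.
  have hrel := airyMoment_add_add_eq_zero (c := -v₁ ^ 2) (by
    rw [f₁]; linear_combination (1 / 4) * hs3 * I ^ 2 + 3 / 4 * I_sq) ζ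
  have hc2 : (-v₁ ^ 2) ^ 2 = -v₂ ^ 2 := by
    rw [f₁, f₂]; linear_combination (1 / 4) * hs3 * I ^ 2 + 3 / 4 * I_sq
  rw [hc2] at hrel
  have hz : ((-ζ : ℝ) : ℂ) = -ζ := by push_cast; rfl
  have g₁ : v₁ ^ 2 * cexp (((Real.pi / 6 : ℝ) : ℂ) / 2 * I) = cexp (-(Real.pi / 4 * I)) := by
    rw [hv₁, ← Complex.exp_nat_mul, ← Complex.exp_add]; congr 1; push_cast; ring
  have g₂ : v₂ ^ 2 * cexp (((-(Real.pi / 6) : ℝ) : ℂ) / 2 * I) = cexp (Real.pi / 4 * I) := by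
    rw [hv₂, ← Complex.exp_nat_mul, ← Complex.exp_add]; congr 1; push_cast; ring
  simp only [Function.comp_apply]
  rw [abs_of_neg hζ, airySol, airyPlus, airyMinus, ← sqrt_sqrt_eq_rpow (neg_nonneg.2 hζ.le), ← g₁,
    ← g₂, hz]
  have k₁ : -(2 / 3 * ((-1 : ℝ) : ℂ) * ((-ζ) ^ (3 / 2 : ℝ) : ℝ) * I)
      = I * ((2 / 3 * (-ζ) ^ (3 / 2 : ℝ) : ℝ) : ℂ) := by push_cast; ring
  have k₂ : -(2 / 3 * ((1 : ℝ) : ℂ) * ((-ζ) ^ (3 / 2 : ℝ) : ℝ) * I)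
      = -(I * ((2 / 3 * (-ζ) ^ (3 / 2 : ℝ) : ℝ) : ℂ)) := by push_cast; ring
  rw [k₁, k₂, show v₁ ^ 2 * -(ζ : ℂ) = -v₁ ^ 2 * ζ by ring,
    show v₂ ^ 2 * -(ζ : ℂ) = -v₂ ^ 2 * ζ by ring]
  linear_combination (-(√(√(-ζ)) : ℂ)) * hrel

/-- A periodic function with limit 0 vanishes identically; its values at 0 and π/2 then determine
both coefficients. -/
lemma eq_zero_of_tendsto_waves {α β : ℂ}
    (h : Tendsto (fun ξ : ℝ => α * cexp (I * ξ) + β * cexp (-(I * ξ))) atTop (𝓝 0)) :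
    α = 0 ∧ β = 0 := by
  have key (x : ℝ) : α * cexp (I * x) + β * cexp (-(I * x)) = 0 := by
    have hx : Tendsto (fun n : ℕ => x + n * (2 * Real.pi)) atTop atTop :=
      tendsto_atTop_add_const_left _ _
        (tendsto_natCast_atTop_atTop.atTop_mul_const Real.two_pi_pos)
    refine tendsto_nhds_unique (tendsto_const_nhds.congr fun n => ?_) (h.comp hx)
    have e (y : ℂ) (k : ℤ) : cexp (y + k * (2 * Real.pi * I)) = cexp y := by
      rw [Complex.exp_add, exp_int_mul_two_pi_mul_I, mul_one]
    have e1 : I * ((x + n * (2 * Real.pi) : ℝ) : ℂ) = I * x + (n : ℤ) * (2 * Real.pi * I) := by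
      push_cast; ring
    have e2 : -(I * ((x + n * (2 * Real.pi) : ℝ) : ℂ))
        = -(I * x) + (-n : ℤ) * (2 * Real.pi * I) := by push_cast; ring
    simp only [Function.comp_apply]
    rw [e2, e1, e, e]
  have h0 := key 0
  have h1 := key (Real.pi / 2)
  have e1 : I * ((Real.pi / 2 : ℝ) : ℂ) = Real.pi / 2 * I := by push_cast; ring
  rw [e1, exp_pi_div_two_mul_I, Complex.exp_neg, exp_pi_div_two_mul_I, inv_I] at h1
  simp only [ofReal_zero, mul_zero, Complex.exp_zero, mul_one, neg_zero] at h0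
  have h2 : α - β = 0 := by
    linear_combination -I * h1 + (α - β) * I_sq
  exact ⟨by linear_combination (h0 + h2) / 2, by linear_combination (h0 - h2) / 2⟩

lemma HasAllowedForm.unique {φ : ℝ → ℂ} {a b a' b' : ℂ} (h : HasAllowedForm φ a b)
    (h' : HasAllowedForm φ a' b') : a = a' ∧ b = b' := by
  -- This substitution for ζ makes the phase (2/3)|ζ|^(3/2) equal to ξ.
  have hg : Tendsto (fun ξ : ℝ => -(3 / 2 * ξ) ^ (2 / 3 : ℝ)) atTop atBot :=
    tendsto_neg_atTop_atBot.comp ((tendsto_rpow_atTop (by norm_num)).comp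
      (tendsto_id.const_mul_atTop (by norm_num)))
  have h2 := (h'.sub h).comp hg
  rw [sub_zero] at h2
  have h3 : Tendsto (fun ξ : ℝ => (a - a') * cexp (I * ξ) + (b - b') * cexp (-(I * ξ))) atTop
      (𝓝 0) := by
    refine h2.congr' ?_
    filter_upwards [eventually_gt_atTop 0] with ξ hξ
    have e : 2 / 3 * |-(3 / 2 * ξ) ^ (2 / 3 : ℝ)| ^ (3 / 2 : ℝ) = ξ := by
      rw [abs_neg, abs_of_nonneg (by positivity), ← Real.rpow_mul (by positivity)]
      norm_num
      ring
    simp only [Function.comp_apply]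
    rw [e]
    ring
  obtain ⟨h4, h5⟩ := eq_zero_of_tendsto_waves h3
  exact ⟨sub_eq_zero.1 h4, sub_eq_zero.1 h5⟩

lemma HasForbiddenForm.const_mul {φ : ℝ → ℂ} {c : ℂ} (h : HasForbiddenForm φ c) (t : ℂ) :
    HasForbiddenForm (fun ζ => t * φ ζ) (t * c) :=
  (Tendsto.const_mul t h).congr fun ζ => by ring

lemma HasAllowedForm.const_mul {φ : ℝ → ℂ} {a b : ℂ} (h : HasAllowedForm φ a b) (t : ℂ) :
    HasAllowedForm (fun ζ => t * φ ζ) (t * a) (t * b) := by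
  have := Tendsto.const_mul t h
  rw [mul_zero] at this
  exact this.congr fun ζ => by ring

/-- Connection formula: a solution of Airy's equation that is recessive on the forbidden side has
fixed ratio of the two waves on the allowed side. -/
lemma IsAirySolution.connection {φ : ℝ → ℂ} {c a b : ℂ} (hφ : IsAirySolution φ)
    (h : HasForbiddenForm φ c) (h' : HasAllowedForm φ a b) :
    ∃ t, a = t * airyPlus ∧ b = t * airyMinus := by
  obtain ⟨t, ht⟩ := h.exists_eq_airySol hφ
  obtain rfl : φ = fun ζ => t * airySol ζ := funext ht
  exact ⟨t, h'.unique (hasAllowedForm_airySol.const_mul t)⟩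

/-! ### Linearised form of WKB functions at a turning point -/

lemma tendsto_integral_div_rpow {g : ℝ → ℝ} (hg : Continuous g) {l : ℝ}
    (h : Tendsto (fun t => g t / √t) (𝓝[>] 0) (𝓝 l)) :
    Tendsto (fun y => (∫ t in (0 : ℝ)..y, g t) / y ^ (3 / 2 : ℝ)) (𝓝[>] 0) (𝓝 (2 / 3 * l)) := by
  have hD (x : ℝ) (hx : 0 < x) : HasDerivAt (fun y : ℝ => y ^ (3 / 2 : ℝ)) (3 / 2 * √x) x := by
    convert Real.hasDerivAt_rpow_const (p := 3 / 2) (Or.inl hx.ne') using 2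
    rw [Real.sqrt_eq_rpow]; norm_num
  refine HasDerivAt.lhopital_zero_nhdsGT (f' := g) (g' := fun x => 3 / 2 * √x)
    (Eventually.of_forall fun x => hg.integral_hasStrictDerivAt 0 x |>.hasDerivAt) ?_ ?_ ?_ ?_ ?_
  · filter_upwards [self_mem_nhdsWithin] with x hx using hD x hx
  · filter_upwards [self_mem_nhdsWithin] with x hx
    have : 0 < √x := Real.sqrt_pos.2 hx
    positivity
  · have : Tendsto (fun y => ∫ t in (0 : ℝ)..y, g t) (𝓝 0) (𝓝 (∫ t in (0 : ℝ)..0, g t)) :=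
      (hg.integral_hasStrictDerivAt 0 0).hasDerivAt.continuousAt
    rw [intervalIntegral.integral_same] at this
    exact this.mono_left nhdsWithin_le_nhds
  · have : Tendsto (fun y : ℝ => y ^ (3 / 2 : ℝ)) (𝓝 0) (𝓝 (0 ^ (3 / 2 : ℝ))) :=
      (Real.continuousAt_rpow_const 0 _ (Or.inr (by norm_num)))
    rw [Real.zero_rpow (by norm_num)] at this
    exact this.mono_left nhdsWithin_le_nhds
  · refine (h.const_mul (2 / 3)).congr fun x => ?_
    rw [div_mul_eq_div_div, div_div_eq_mul_div (g x)]
    ring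

lemma tendsto_abs_integral_div_rpow {f : ℝ → ℝ} (hf : Continuous f) {x₀ l : ℝ} (hl : 0 ≤ l)
    (h : Tendsto (fun x => f x / √|x - x₀|) (𝓝[≠] x₀) (𝓝 l)) :
    Tendsto (fun x => |∫ t in x₀..x, f t| / |x - x₀| ^ (3 / 2 : ℝ)) (𝓝[≠] x₀)
      (𝓝 (2 / 3 * l)) := by
  rw [← nhdsLT_sup_nhdsGT, tendsto_sup] at h ⊢
  have habs : |2 / 3 * l| = 2 / 3 * l := abs_of_nonneg (by positivity)
  constructor
  · have h0 : Tendsto (fun t => x₀ - t) (𝓝[>] 0) (𝓝[<] x₀) := by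
      refine tendsto_nhdsWithin_iff.2 ⟨?_, ?_⟩
      · have : Tendsto (fun t : ℝ => x₀ - t) (𝓝 0) (𝓝 (x₀ - 0)) :=
          Continuous.tendsto (by fun_prop) _
        rw [sub_zero] at this
        exact this.mono_left nhdsWithin_le_nhds
      · filter_upwards [self_mem_nhdsWithin] with t ht
        have : 0 < t := ht
        simpa using this
    have h1 : Tendsto (fun x => x₀ - x) (𝓝[<] x₀) (𝓝[>] 0) := by
      refine tendsto_nhdsWithin_iff.2 ⟨?_, ?_⟩
      · have : Tendsto (fun t : ℝ => x₀ - t) (𝓝 x₀) (𝓝 (x₀ - x₀)) :=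
          Continuous.tendsto (by fun_prop) _
        rw [sub_self] at this
        exact this.mono_left nhdsWithin_le_nhds
      · filter_upwards [self_mem_nhdsWithin] with t ht
        have : t < x₀ := ht
        simpa using this
    have h2 := ((tendsto_integral_div_rpow (g := fun t => f (x₀ - t)) (by fun_prop)
      ((h.1.comp h0).congr' (by
        filter_upwards [self_mem_nhdsWithin] with t ht
        have ht' : 0 < t := ht
        simp [abs_of_pos ht']))).comp h1).abs
    rw [habs] at h2
    refine h2.congr' ?_
    filter_upwards [self_mem_nhdsWithin] with x hx
    have hx' : 0 < x₀ - x := sub_pos.2 hx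
    simp only [Function.comp_apply]
    rw [abs_div, intervalIntegral.integral_comp_sub_left f x₀, sub_sub_cancel, sub_zero,
      intervalIntegral.integral_symm, abs_neg, abs_sub_comm x x₀, abs_of_pos hx',
      abs_of_nonneg (Real.rpow_nonneg hx'.le _)]
  · have h0 : Tendsto (fun t => x₀ + t) (𝓝[>] 0) (𝓝[>] x₀) := by
      refine tendsto_nhdsWithin_iff.2 ⟨?_, ?_⟩
      · have : Tendsto (fun t : ℝ => x₀ + t) (𝓝 0) (𝓝 (x₀ + 0)) :=
          Continuous.tendsto (by fun_prop) _
        rw [add_zero] at this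
        exact this.mono_left nhdsWithin_le_nhds
      · filter_upwards [self_mem_nhdsWithin] with t ht
        have : 0 < t := ht
        simpa using this
    have h1 : Tendsto (fun x => x - x₀) (𝓝[>] x₀) (𝓝[>] 0) := by
      refine tendsto_nhdsWithin_iff.2 ⟨?_, ?_⟩
      · have : Tendsto (fun t : ℝ => t - x₀) (𝓝 x₀) (𝓝 (x₀ - x₀)) :=
          Continuous.tendsto (by fun_prop) _
        rw [sub_self] at this
        exact this.mono_left nhdsWithin_le_nhds
      · filter_upwards [self_mem_nhdsWithin] with t ht
        have : x₀ < t := ht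
        simpa using this
    have h2 := ((tendsto_integral_div_rpow (g := fun t => f (x₀ + t)) (by fun_prop)
      ((h.2.comp h0).congr' (by
        filter_upwards [self_mem_nhdsWithin] with t ht
        have ht' : 0 < t := ht
        simp [abs_of_pos ht']))).comp h1).abs
    rw [habs] at h2
    refine h2.congr' ?_
    filter_upwards [self_mem_nhdsWithin] with x hx
    have hx' : 0 < x - x₀ := sub_pos.2 hx
    simp only [Function.comp_apply]
    rw [abs_div, intervalIntegral.integral_comp_add_left f x₀, add_sub_cancel, add_zero,
      abs_of_pos hx', abs_of_nonneg (Real.rpow_nonneg hx'.le _)]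

lemma tendsto_abs_sub_sq_div {m : ℝ → ℝ} {En xτ m' : ℝ} (hm : HasDerivAt m m' xτ)
    (hE : m xτ ^ 2 = En) :
    Tendsto (fun x => |En - m x ^ 2| / |x - xτ|) (𝓝[≠] xτ) (𝓝 |2 * m xτ * m'|) := by
  have h := ((hm.pow 2).const_sub En)
  have h2 := (hasDerivAt_iff_tendsto_slope.1 h).abs
  have e : |-(((2 : ℕ) : ℝ) * m xτ ^ (2 - 1) * m')| = |2 * m xτ * m'| := by
    rw [abs_neg]; norm_num
  rw [e] at h2
  refine h2.congr fun x => ?_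
  simp only [slope_def_field, Pi.pow_apply, hE, sub_self, sub_zero, abs_div]

/-- The scale of the inner variable at the turning point `xτ`. -/
noncomputable def airyScale (m : ℝ → ℝ) (ε xτ : ℝ) : ℝ :=
  |2 * m xτ * deriv m xτ| ^ (1 / 3 : ℝ) * ε ^ (-(2 / 3) : ℝ)

/-- The limit of `|ζ|^{1/4} |En - m²|^{-1/4}` at the turning point `xτ`. -/
noncomputable def overlapGain (m : ℝ → ℝ) (ε xτ : ℝ) : ℝ :=
  airyScale m ε xτ ^ (1 / 4 : ℝ) * (|2 * m xτ * deriv m xτ| ^ (1 / 4 : ℝ))⁻¹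

/-- The modulus `√|En - m²|` of the derivative of the leading phase. -/
noncomputable def momentum (m : ℝ → ℝ) (En x : ℝ) : ℝ := √|En - m x ^ 2|

section Overlap

variable {m : ℝ → ℝ} {ε xτ : ℝ}

lemma airyScale_pos (hε : 0 < ε) (hl : 2 * m xτ * deriv m xτ ≠ 0) : 0 < airyScale m ε xτ := by
  have := abs_pos.2 hl
  unfold airyScale
  positivity

lemma overlapGain_pos (hε : 0 < ε) (hl : 2 * m xτ * deriv m xτ ≠ 0) :
    0 < overlapGain m ε xτ := by
  have := abs_pos.2 hl
  have := airyScale_pos hε hl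
  unfold overlapGain
  positivity

lemma abs_airyVar (hε : 0 < ε) (hl : 2 * m xτ * deriv m xτ ≠ 0) (x : ℝ) :
    |airyVar m ε xτ x| = airyScale m ε xτ * |x - xτ| := by
  have hs : |Real.sign (2 * m xτ * deriv m xτ)| = 1 := by
    rcases Real.sign_apply_eq_of_ne_zero _ hl with h | h <;> simp [h]
  have : 0 < |2 * m xτ * deriv m xτ| := abs_pos.2 hl
  rw [airyVar, airyScale, abs_mul, abs_mul, abs_mul, hs, one_mul,
    abs_of_pos (a := _ ^ (1 / 3 : ℝ)) (by positivity), abs_of_pos (a := ε ^ _) (by positivity)]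

/-- The scaling ε^(-2/3) raised to the power 3/2 cancels the prefactor ε, so the condition on the
leading phase does not depend on ε. -/
lemma mul_abs_airyVar_rpow (hε : 0 < ε) (hl : 2 * m xτ * deriv m xτ ≠ 0) (x : ℝ) :
    ε * |airyVar m ε xτ x| ^ (3 / 2 : ℝ)
      = √|2 * m xτ * deriv m xτ| * |x - xτ| ^ (3 / 2 : ℝ) := by
  have hA := airyScale_pos hε hl
  rw [abs_airyVar hε hl, Real.mul_rpow hA.le (abs_nonneg _), airyScale,
    Real.mul_rpow (by positivity) (by positivity), ← Real.rpow_mul (abs_nonneg _),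
    ← Real.rpow_mul hε.le, Real.sqrt_eq_rpow]
  norm_num
  rw [Real.rpow_neg_one]
  field_simp

lemma tendsto_abs_airyVar_rpow_mul {En : ℝ} (hε : 0 < ε) (hm : DifferentiableAt ℝ m xτ)
    (hE : m xτ ^ 2 = En) (hl : 2 * m xτ * deriv m xτ ≠ 0) :
    Tendsto (fun x => |airyVar m ε xτ x| ^ (1 / 4 : ℝ) * (|En - m x ^ 2| ^ (1 / 4 : ℝ))⁻¹)
      (𝓝[≠] xτ) (𝓝 (overlapGain m ε xτ)) := by
  have h := (tendsto_abs_sub_sq_div hm.hasDerivAt hE).rpow_const (p := 1 / 4)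
    (Or.inl (abs_ne_zero.2 hl))
  have h2 := (h.inv₀ (Real.rpow_pos_of_pos (abs_pos.2 hl) _).ne').const_mul
    (airyScale m ε xτ ^ (1 / 4 : ℝ))
  refine h2.congr' ?_
  filter_upwards [self_mem_nhdsWithin] with x hx
  have hx' : 0 < |x - xτ| := abs_pos.2 (sub_ne_zero.2 hx)
  rw [abs_airyVar hε hl, Real.mul_rpow (airyScale_pos hε hl).le hx'.le,
    Real.div_rpow (abs_nonneg _) hx'.le, inv_div]
  ring

variable {En : ℝ} {U : Set ℝ} {p : WKBPhase}

lemma tendsto_amplitude (hε : 0 < ε) (hm : DifferentiableAt ℝ m xτ) (hE : m xτ ^ 2 = En)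
    (hl : 2 * m xτ * deriv m xτ ≠ 0) (hU : xτ ∉ U) {g : ℝ → ℂ} {g₀ : ℂ}
    (hp : ∀ x ∈ U, cexp (I * p.S1 x) = ((|En - m x ^ 2| ^ (1 / 4 : ℝ))⁻¹ : ℝ) * g x)
    (hg : Tendsto g (𝓝[U] xτ) (𝓝 g₀)) :
    Tendsto (fun x : ℝ => ((|airyVar m ε xτ x| ^ (1 / 4 : ℝ) : ℝ) : ℂ) * cexp (I * p.S1 x))
      (𝓝[U] xτ) (𝓝 (overlapGain m ε xτ * g₀)) := by
  have hle : 𝓝[U] xτ ≤ 𝓝[≠] xτ := nhdsWithin_mono _ fun x hx h => hU (h ▸ hx)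
  refine ((((continuous_ofReal.tendsto _).comp
    ((tendsto_abs_airyVar_rpow_mul hε hm hE hl).mono_left hle))).mul hg).congr' ?_
  filter_upwards [self_mem_nhdsWithin] with x hx
  rw [hp x hx]
  simp only [Function.comp_apply, ofReal_mul]
  ring

/-- The momentum behaves like √|λ| √|x - xτ| near the turning point, so its integral has exactly the
leading behaviour demanded of S₀. The factor g collects the constant amplitude and the σ-dependent
factor. -/
lemma WKBPhase.hasOverlapForm_of_eq (hε : 0 < ε) (hmc : Continuous m)
    (hm : DifferentiableAt ℝ m xτ) (hE : m xτ ^ 2 = En) (hl : 2 * m xτ * deriv m xτ ≠ 0)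
    (hU : xτ ∉ U) {g : ℝ → ℂ} {a s g₀ : ℂ}
    (hS : ∀ x ∈ U, p.S0 x = a + s * (|∫ t in xτ..x, momentum m En t| : ℝ))
    (hp : ∀ x ∈ U, cexp (I * p.S1 x) = ((|En - m x ^ 2| ^ (1 / 4 : ℝ))⁻¹ : ℝ) * g x)
    (hg : Tendsto g (𝓝[U] xτ) (𝓝 g₀)) :
    p.HasOverlapForm m ε xτ U s (cexp (I * a / ε) * (overlapGain m ε xτ * g₀)) := by
  refine ⟨a, _, ?_, tendsto_amplitude hε hm hE hl hU hp hg, rfl⟩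
  have hle : 𝓝[U] xτ ≤ 𝓝[≠] xτ := nhdsWithin_mono _ fun x hx h => hU (h ▸ hx)
  have hl' : 0 < √|2 * m xτ * deriv m xτ| := Real.sqrt_pos.2 (abs_pos.2 hl)
  have h1 := tendsto_abs_integral_div_rpow (f := momentum m En) (by unfold momentum; fun_prop)
    (Real.sqrt_nonneg _) (((tendsto_abs_sub_sq_div hm.hasDerivAt hE).sqrt).congr fun x =>
      Real.sqrt_div (abs_nonneg _) _)
  have h2 := (h1.div_const (√|2 * m xτ * deriv m xτ|)).mono_left hle
  rw [mul_div_cancel_right₀ _ hl'.ne'] at h2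
  have h3 := ((continuous_ofReal.tendsto _).comp h2).const_mul s
  push_cast at h3
  refine h3.congr' ?_
  filter_upwards [self_mem_nhdsWithin] with x hx
  rw [hS x hx, mul_abs_airyVar_rpow hε hl, add_sub_cancel_left]
  simp only [Function.comp_apply]
  rw [mul_div_assoc, ← ofReal_div, div_div, mul_comm √_]

/-- The coefficient is not free: the denominator of the phase condition tends to 0, which forces the
constant there to be the limit of S₀, and the amplitude limit is unique. -/
lemma WKBPhase.HasOverlapForm.exists_coeff {s c : ℂ} (h : p.HasOverlapForm m ε xτ U s c)
    (hε : 0 < ε) (hm : DifferentiableAt ℝ m xτ) (hE : m xτ ^ 2 = En)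
    (hl : 2 * m xτ * deriv m xτ ≠ 0) (hU : xτ ∉ U) (hU' : (𝓝[U] xτ).NeBot) {g : ℝ → ℂ} {g₀ : ℂ}
    (hp : ∀ x ∈ U, cexp (I * p.S1 x) = ((|En - m x ^ 2| ^ (1 / 4 : ℝ))⁻¹ : ℝ) * g x)
    (hg : Tendsto g (𝓝[U] xτ) (𝓝 g₀)) :
    ∃ a, Tendsto p.S0 (𝓝[U] xτ) (𝓝 a) ∧
      c = cexp (I * a / ε) * (overlapGain m ε xτ * g₀) := by
  obtain ⟨a, b, h0, h1, rfl⟩ := h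
  refine ⟨a, ?_, by rw [tendsto_nhds_unique h1 (tendsto_amplitude hε hm hE hl hU hp hg)]⟩
  have hD : Tendsto (fun x : ℝ => ((ε * |airyVar m ε xτ x| ^ (3 / 2 : ℝ) : ℝ) : ℂ)) (𝓝[U] xτ)
      (𝓝 0) := by
    have hc : Tendsto (fun x : ℝ => √|2 * m xτ * deriv m xτ| * |x - xτ| ^ (3 / 2 : ℝ)) (𝓝 xτ)
        (𝓝 (√|2 * m xτ * deriv m xτ| * |xτ - xτ| ^ (3 / 2 : ℝ))) := by
      refine Tendsto.const_mul _ (Tendsto.rpow_const ?_ (Or.inr (by norm_num)))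
      exact Continuous.tendsto (by fun_prop) xτ
    rw [sub_self, abs_zero, Real.zero_rpow (by norm_num), mul_zero] at hc
    have := (continuous_ofReal.tendsto 0).comp (hc.mono_left (nhdsWithin_le_nhds (s := U)))
    rw [ofReal_zero] at this
    refine this.congr fun x => ?_
    rw [mul_abs_airyVar_rpow hε hl]
    rfl
  have h2 := (h0.mul hD).add_const a
  rw [mul_zero, zero_add] at h2
  refine h2.congr' ?_
  filter_upwards [self_mem_nhdsWithin] with x hx
  have hx' : 0 < |x - xτ| := abs_pos.2 (sub_ne_zero.2 fun h => hU (h ▸ hx))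
  have hne : ((ε * |airyVar m ε xτ x| ^ (3 / 2 : ℝ) : ℝ) : ℂ) ≠ 0 := by
    rw [ofReal_ne_zero, mul_abs_airyVar_rpow hε hl]
    have : 0 < √|2 * m xτ * deriv m xτ| := Real.sqrt_pos.2 (abs_pos.2 hl)
    positivity
  rw [div_mul_cancel₀ _ hne, sub_add_cancel]

end Overlap

/-! ### Explicit solution of the phase equations -/

lemma eq_of_hasDerivAt_zero_of_Ioo {f : ℝ → ℂ} {a b : ℝ} (hf : ∀ x ∈ Set.Ioo a b, HasDerivAt f 0 x)
    {x y : ℝ} (hx : x ∈ Set.Ioo a b) (hy : y ∈ Set.Ioo a b) : f x = f y := by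
  refine (convex_Ioo a b).is_const_of_fderivWithin_eq_zero (𝕜 := ℝ)
    (fun z hz => (hf z hz).differentiableAt.differentiableWithinAt) (fun z hz => ?_) hx hy
  rw [fderivWithin_of_isOpen isOpen_Ioo hz, (hf z hz).hasFDerivAt.fderiv]
  ext
  simp

/-- Differentiating the eikonal equation eliminates S₀'' from the transport equation. -/
lemma mul_deriv_eq_of_sq_eq {P : ℝ → ℂ} {P' : ℂ} {m : ℝ → ℝ} {En x : ℝ}
    (hP : HasDerivAt P P' x) (hm : DifferentiableAt ℝ m x)
    (h : ∀ᶠ y in 𝓝 x, P y ^ 2 = ((En - m y ^ 2 : ℝ) : ℂ)) :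
    P x * P' = -(m x * deriv m x : ℝ) := by
  have h1 : HasDerivAt (fun y => ((En - m y ^ 2 : ℝ) : ℂ))
      ((-(2 * (m x * deriv m x)) : ℝ) : ℂ) x := by
    refine HasDerivAt.ofReal_comp ?_
    exact ((hm.hasDerivAt.pow 2).const_sub En).congr_deriv (by simp; ring)
  have h2 := ((hP.pow 2).congr_of_eventuallyEq (h.mono fun y hy => hy.symm)).unique h1
  norm_num at h2
  push_cast
  linear_combination h2 / 2

section Phase

variable {m : ℝ → ℝ} {σ : ℤ} {En : ℝ} {U : Set ℝ}

lemma WKBPhase.Solves.I_mul_deriv_S1 {p : WKBPhase} (hp : p.Solves m σ En U)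
    (hm : Differentiable ℝ m) (hU : IsOpen U) {x : ℝ} (hx : x ∈ U) (hq : En - m x ^ 2 ≠ 0) :
    I * deriv p.S1 x = (m x * deriv m x / (2 * (En - m x ^ 2)) : ℝ)
      - I * σ * deriv m x / (2 * deriv p.S0 x) := by
  have h1 := mul_deriv_eq_of_sq_eq (hp.diff_deriv_S0 x hx).hasDerivAt (hm x)
    (eventually_of_mem (hU.mem_nhds hx) hp.eikonal)
  have h2 := hp.eikonal x hx
  have h3 := hp.transport x hx
  have hq' : ((En - m x ^ 2 : ℝ) : ℂ) ≠ 0 := ofReal_ne_zero.2 hq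
  have hP : deriv p.S0 x ≠ 0 := by
    intro h
    rw [h] at h2
    exact hq' (by rw [← h2]; ring)
  rw [ofReal_div, ofReal_mul 2, ← h2]
  push_cast at h1 h3 ⊢
  field_simp
  linear_combination I * deriv p.S0 x * h3 + deriv p.S0 x * deriv (deriv p.S0) x * I_sq - h1

/-- The WKB phase with `S₀' = c √|En - m²|` that vanishes at `x₀`, where `θ' = m' / √|En - m²|`. -/
noncomputable def wkbPhase (m : ℝ → ℝ) (σ : ℤ) (En x₀ : ℝ) (c : ℂ) (θ : ℝ → ℝ) (β : ℂ) :
    WKBPhase where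
  S0 x := c * (∫ t in x₀..x, momentum m En t : ℝ)
  S1 x := β + I / 4 * (Real.log (En - m x ^ 2) : ℝ) - σ / (2 * c) * θ x

/-- Since `Real.log q` means log |q|, one formula for S₁ covers the allowed region (q > 0) and the
forbidden ones (q < 0). -/
lemma exp_log_div_four {q : ℝ} (hq : q ≠ 0) :
    cexp ((Real.log q : ℝ) / 4) = (|q| ^ (1 / 4 : ℝ) : ℝ) := by
  rw [Real.rpow_def_of_pos (abs_pos.2 hq), Real.log_abs]
  push_cast
  ring_nf

lemma exp_I_mul_wkbPhase_S1 {x₀ x : ℝ} {c β : ℂ} {θ : ℝ → ℝ} (hq : En - m x ^ 2 ≠ 0) :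
    cexp (I * (wkbPhase m σ En x₀ c θ β).S1 x) = ((|En - m x ^ 2| ^ (1 / 4 : ℝ))⁻¹ : ℝ)
      * (cexp (I * β) * cexp (-(I * σ / (2 * c) * θ x))) := by
  rw [ofReal_inv, ← exp_log_div_four hq, ← Complex.exp_neg, ← Complex.exp_add, ← Complex.exp_add]
  congr 1
  simp only [wkbPhase]
  linear_combination (Real.log (En - m x ^ 2) / 4 : ℂ) * I_sq

lemma continuous_momentum (hm : Continuous m) : Continuous (momentum m En) := by
  unfold momentum
  fun_prop

lemma momentum_sq (x : ℝ) : momentum m En x ^ 2 = |En - m x ^ 2| := Real.sq_sqrt (abs_nonneg _)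

lemma hasDerivAt_wkbPhase_S0 (hm : Continuous m) {x₀ : ℝ} {c β : ℂ} {θ : ℝ → ℝ} (x : ℝ) :
    HasDerivAt (wkbPhase m σ En x₀ c θ β).S0 (c * momentum m En x) x :=
  (((continuous_momentum hm).integral_hasStrictDerivAt x₀ x).hasDerivAt.ofReal_comp).const_mul c

lemma deriv_wkbPhase_S0 (hm : Continuous m) {x₀ : ℝ} {c β : ℂ} {θ : ℝ → ℝ} :
    deriv (wkbPhase m σ En x₀ c θ β).S0 = fun x => c * (momentum m En x : ℂ) :=
  funext fun x => (hasDerivAt_wkbPhase_S0 hm x).deriv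

lemma differentiableAt_momentum (hm : Differentiable ℝ m) {x : ℝ} (hq : En - m x ^ 2 ≠ 0) :
    DifferentiableAt ℝ (momentum m En) x := by
  refine DifferentiableAt.sqrt (DifferentiableAt.abs ?_ hq) (abs_ne_zero.2 hq)
  have := hm x
  fun_prop

/-- The condition `hcq` says that c² is the sign of En - m²: it is applied with c = ±1 on the
allowed region and c = ±I on the forbidden ones. -/
lemma wkbPhase_solves (hm : Differentiable ℝ m) (hU : IsOpen U) {x₀ : ℝ} {c β : ℂ} {θ : ℝ → ℝ}
    (hc : c ≠ 0) (hq : ∀ x ∈ U, En - m x ^ 2 ≠ 0)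
    (hcq : ∀ x ∈ U, c ^ 2 * (|En - m x ^ 2| : ℝ) = ((En - m x ^ 2 : ℝ) : ℂ))
    (hθ : ∀ x ∈ U, HasDerivAt θ (deriv m x / momentum m En x) x) :
    (wkbPhase m σ En x₀ c θ β).Solves m σ En U := by
  have hd0 := deriv_wkbPhase_S0 (σ := σ) (En := En) (x₀ := x₀) (c := c) (θ := θ) (β := β)
    hm.continuous
  have hd1 : ∀ x ∈ U, HasDerivAt (wkbPhase m σ En x₀ c θ β).S1
      (-(I / 2) * (m x * deriv m x / (En - m x ^ 2) : ℝ)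
        - σ / (2 * c) * (deriv m x / momentum m En x : ℝ)) x := by
    intro x hx
    have h1 : HasDerivAt (fun y => Real.log (En - m y ^ 2))
        (-(2 * (m x * deriv m x)) / (En - m x ^ 2)) x := by
      refine HasDerivAt.log ?_ (hq x hx)
      exact (((hm x).hasDerivAt.pow 2).const_sub En).congr_deriv (by simp; ring)
    refine (((h1.ofReal_comp.const_mul (I / 4)).const_add β).sub
      ((hθ x hx).ofReal_comp.const_mul (σ / (2 * c)))).congr_deriv ?_
    push_cast
    ring
  have hdP : ∀ x ∈ U, DifferentiableAt ℝ (fun x => c * (momentum m En x : ℂ)) x := fun x hx =>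
    (((differentiableAt_momentum hm (hq x hx)).hasDerivAt.ofReal_comp).const_mul c).differentiableAt
  have heik : ∀ x ∈ U, (c * (momentum m En x : ℂ)) ^ 2 = ((En - m x ^ 2 : ℝ) : ℂ) := by
    intro x hx
    rw [mul_pow, ← ofReal_pow, momentum_sq, hcq x hx]
  refine ⟨fun x hx => (hasDerivAt_wkbPhase_S0 hm.continuous x).differentiableAt, ?_,
    fun x hx => (hd1 x hx).differentiableAt, ?_, fun x hx => ?_⟩
  · rwa [hd0]
  · rwa [hd0]
  · rw [(hd1 x hx).deriv, hd0]
    have h1 := mul_deriv_eq_of_sq_eq (hdP x hx).hasDerivAt (hm x)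
      (eventually_of_mem (hU.mem_nhds hx) heik)
    have h2 := heik x hx
    have hM : (momentum m En x : ℂ) ≠ 0 :=
      ofReal_ne_zero.2 (Real.sqrt_pos.2 (abs_pos.2 (hq x hx))).ne'
    rw [ofReal_div (m x * deriv m x), ← h2]
    generalize deriv (fun x => c * (momentum m En x : ℂ)) x = P' at h1 ⊢
    push_cast at h1 ⊢
    field_simp
    linear_combination (-I) * h1

end Phase

/-! ### Position of the turning points and the sign of En - m² -/

namespace IsMassProfile

variable {m : ℝ → ℝ}

lemma differentiable (hm : IsMassProfile m) : Differentiable ℝ m :=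
  hm.contDiff.differentiable (by norm_num)

end IsMassProfile

namespace AreTurningPoints

variable {m : ℝ → ℝ} {En xm xp : ℝ}

lemma map_right (h : AreTurningPoints m En xm xp) (hm : IsMassProfile m) : m xp = √En := by
  have h1 := hm.strictMono h.lt
  have h2 : m xm = -m xp := by
    rcases sq_eq_sq_iff_eq_or_eq_neg.1 (h.left.trans h.right.symm) with h | h
    · linarith
    · exact h
  rw [← h.right, Real.sqrt_sq (by linarith)]

lemma map_left (h : AreTurningPoints m En xm xp) (hm : IsMassProfile m) : m xm = -√En := by
  have h1 := hm.strictMono h.lt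
  rcases sq_eq_sq_iff_eq_or_eq_neg.1 (h.left.trans h.right.symm) with h2 | h2
  · linarith
  · rw [h2, h.map_right hm]

lemma energy_pos (h : AreTurningPoints m En xm xp) (hm : IsMassProfile m) : 0 < En := by
  have h1 := hm.strictMono h.lt
  rw [h.map_right hm, h.map_left hm] at h1
  exact Real.sqrt_pos.1 (by linarith)

lemma pos_of_mem (h : AreTurningPoints m En xm xp) (hm : IsMassProfile m) {x : ℝ}
    (hx : x ∈ Set.Ioo xm xp) : 0 < En - m x ^ 2 := by
  have h1 := hm.strictMono hx.1
  have h2 := hm.strictMono hx.2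
  rw [h.map_left hm] at h1
  rw [h.map_right hm] at h2
  have := Real.sq_sqrt (h.energy_pos hm).le
  nlinarith

lemma lt_of_gt (h : AreTurningPoints m En xm xp) (hm : IsMassProfile m) {x : ℝ}
    (hx : xp < x) : √En < m x := by
  rw [← h.map_right hm]
  exact hm.strictMono hx

lemma lt_neg_of_lt (h : AreTurningPoints m En xm xp) (hm : IsMassProfile m) {x : ℝ}
    (hx : x < xm) : m x < -√En := by
  rw [← h.map_left hm]
  exact hm.strictMono hx

lemma neg_of_gt (h : AreTurningPoints m En xm xp) (hm : IsMassProfile m) {x : ℝ}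
    (hx : xp < x) : En - m x ^ 2 < 0 := by
  have h1 := h.lt_of_gt hm hx
  have := Real.sq_sqrt (h.energy_pos hm).le
  nlinarith [Real.sqrt_nonneg En]

lemma neg_of_lt (h : AreTurningPoints m En xm xp) (hm : IsMassProfile m) {x : ℝ}
    (hx : x < xm) : En - m x ^ 2 < 0 := by
  have h1 := h.lt_neg_of_lt hm hx
  have := Real.sq_sqrt (h.energy_pos hm).le
  nlinarith [Real.sqrt_nonneg En]

lemma slope_left_ne (h : AreTurningPoints m En xm xp) (hm : IsMassProfile m) :
    2 * m xm * deriv m xm ≠ 0 := by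
  have h1 := Real.sqrt_pos.2 (h.energy_pos hm)
  have h2 := h.simple_left
  rw [h.map_left hm]
  exact mul_ne_zero (by linarith) h2.ne'

lemma slope_right_ne (h : AreTurningPoints m En xm xp) (hm : IsMassProfile m) :
    2 * m xp * deriv m xp ≠ 0 := by
  have h1 := Real.sqrt_pos.2 (h.energy_pos hm)
  have h2 := h.simple_right
  rw [h.map_right hm]
  positivity

/-- The function θ for the allowed region. Its total increase π between the turning points is the
source of the σ-dependent phase. -/
lemma hasDerivAt_arcsin (h : AreTurningPoints m En xm xp) (hm : IsMassProfile m) {x : ℝ}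
    (hx : x ∈ Set.Ioo xm xp) :
    HasDerivAt (fun x => Real.arcsin (m x / √En)) (deriv m x / momentum m En x) x := by
  have hE := h.energy_pos hm
  have hs := Real.sqrt_pos.2 hE
  have hq := h.pos_of_mem hm hx
  have h1 : m x / √En ≠ -1 := by
    intro h1
    rw [div_eq_iff hs.ne'] at h1
    rw [h1, mul_pow, Real.sq_sqrt hE.le] at hq
    linarith
  have h2 : m x / √En ≠ 1 := by
    intro h1
    rw [div_eq_iff hs.ne'] at h1
    rw [h1, mul_pow, Real.sq_sqrt hE.le] at hq
    linarith
  refine ((Real.hasDerivAt_arcsin h1 h2).comp x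
    ((hm.differentiable x).hasDerivAt.div_const (√En))).congr_deriv ?_
  have e : 1 - (m x / √En) ^ 2 = (En - m x ^ 2) / En := by
    rw [div_pow, Real.sq_sqrt hE.le]
    field_simp
  rw [e, Real.sqrt_div hq.le, momentum, abs_of_pos hq]
  have := Real.sqrt_pos.2 hq
  field_simp

end AreTurningPoints

/-! ### Decaying WKB functions in the forbidden regions -/

lemma exists_exp_I_mul_eq {D : ℂ} (hD : D ≠ 0) : ∃ β : ℂ, cexp (I * β) = D :=
  ⟨-I * log D, by rw [← mul_assoc, mul_neg, I_mul_I, neg_neg, one_mul, exp_log hD]⟩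

lemma tendsto_integral_atTop_of_tendsto_pos {g : ℝ → ℝ} (hg : Continuous g) {l : ℝ} (hl : 0 < l)
    (h : Tendsto g atTop (𝓝 l)) (a : ℝ) : Tendsto (fun x => ∫ t in a..x, g t) atTop atTop := by
  obtain ⟨X, hX⟩ := eventually_atTop.1 (h.eventually_const_le (half_lt_self hl))
  have h1 : Tendsto (fun x => (∫ t in a..X, g t) + l / 2 * (x - X)) atTop atTop :=
    tendsto_atTop_add_const_left _ _
      ((tendsto_atTop_add_const_right _ _ tendsto_id).const_mul_atTop (half_pos hl))
  refine tendsto_atTop_mono' _ ?_ h1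
  filter_upwards [eventually_ge_atTop X] with x hx
  rw [← intervalIntegral.integral_add_adjacent_intervals (hg.intervalIntegrable a X)
    (hg.intervalIntegrable X x)]
  have h2 : ∫ _ in X..x, l / 2 ≤ ∫ t in X..x, g t :=
    intervalIntegral.integral_mono_on hx (by simp) (hg.intervalIntegrable X x)
      fun t ht => hX t ht.1
  rw [intervalIntegral.integral_const, smul_eq_mul] at h2
  linarith

section Phase

variable {m : ℝ → ℝ} {σ : ℤ} {En ε : ℝ}

lemma momentum_nonneg (x : ℝ) : 0 ≤ momentum m En x := Real.sqrt_nonneg _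

lemma abs_integral_momentum {a b : ℝ} (hab : a ≤ b) :
    |∫ t in a..b, momentum m En t| = ∫ t in a..b, momentum m En t :=
  abs_of_nonneg (intervalIntegral.integral_nonneg hab fun t _ => momentum_nonneg t)

lemma abs_integral_momentum_symm {a b : ℝ} (hab : a ≤ b) :
    |∫ t in b..a, momentum m En t| = ∫ t in a..b, momentum m En t := by
  rw [intervalIntegral.integral_symm, abs_neg, abs_integral_momentum hab]

/-- S₁ has a finite limit, so the decay is decided by the real part of i S₀ alone. -/
lemma tendsto_wkbPhase_mode {l : Filter ℝ} {μ θ₀ x₀ : ℝ} {c β : ℂ} {θ : ℝ → ℝ} (hε : 0 < ε)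
    (hm : Tendsto m l (𝓝 μ)) (hμ : En - μ ^ 2 ≠ 0) (hθ : Tendsto θ l (𝓝 θ₀))
    (hJ : Tendsto (fun x => (I * c).re * ∫ t in x₀..x, momentum m En t) l atBot) :
    Tendsto ((wkbPhase m σ En x₀ c θ β).mode ε) l (𝓝 0) := by
  have hq : Tendsto (fun x => En - m x ^ 2) l (𝓝 (En - μ ^ 2)) := (hm.pow 2).const_sub En
  have h1 : Tendsto (fun x => cexp (I * (wkbPhase m σ En x₀ c θ β).S1 x)) l
      (𝓝 (cexp (I * (β + I / 4 * (Real.log (En - μ ^ 2) : ℝ) - σ / (2 * c) * θ₀)))) := by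
    refine (continuous_exp.tendsto _).comp (Tendsto.const_mul _ (Tendsto.sub
      (Tendsto.const_add _ (Tendsto.const_mul _ ?_)) (Tendsto.const_mul _ ?_)))
    · exact (continuous_ofReal.tendsto _).comp (hq.log hμ)
    · exact (continuous_ofReal.tendsto _).comp hθ
  have h2 : Tendsto (fun x => cexp (I * ((wkbPhase m σ En x₀ c θ β).S0 x / ε))) l (𝓝 0) := by
    rw [tendsto_zero_iff_norm_tendsto_zero]
    refine (Real.tendsto_exp_atBot.comp (hJ.const_mul_atBot (inv_pos.2 hε))).congr fun x => ?_
    rw [norm_exp]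
    simp only [Function.comp_apply, wkbPhase]
    congr 1
    rw [show I * (c * ((∫ t in x₀..x, momentum m En t : ℝ) : ℂ) / ε)
      = (I * c) * ((ε⁻¹ * ∫ t in x₀..x, momentum m En t : ℝ) : ℂ) by push_cast; ring, re_mul_ofReal]
    ring
  have h3 := h2.mul h1
  rw [zero_mul] at h3
  refine h3.congr fun x => ?_
  rw [WKBPhase.mode, mul_add, Complex.exp_add]

end Phase

namespace AreTurningPoints

variable {m : ℝ → ℝ} {σ : ℤ} {En xm xp ε : ℝ}

lemma hasDerivAt_momentum (hm : IsMassProfile m) {x : ℝ} (hq : En - m x ^ 2 < 0) :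
    HasDerivAt (momentum m En) (m x * deriv m x / momentum m En x) x := by
  have h1 : HasDerivAt (fun y => m y ^ 2 - En) (2 * (m x * deriv m x)) x :=
    (((hm.differentiable x).hasDerivAt.pow 2).sub_const En).congr_deriv (by simp; ring)
  have h2 := h1.sqrt (by linarith)
  have hev : momentum m En =ᶠ[𝓝 x] fun y => √(m y ^ 2 - En) := by
    have hc : ContinuousAt (fun y => En - m y ^ 2) x := by
      have := hm.differentiable.continuous
      fun_prop
    filter_upwards [hc.eventually_lt_const hq] with y hy
    rw [momentum, abs_of_neg hy, neg_sub]
  refine (h2.congr_of_eventuallyEq hev).congr_deriv ?_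
  rw [hev.eq_of_nhds]
  ring

/-- Existence of the decaying WKB function on the right forbidden region, with any nonzero
coefficient. -/
lemma exists_right (h : AreTurningPoints m En xm xp) (hm : IsMassProfile m) (hε : 0 < ε)
    (hE : En < 1) {d : ℂ} (hd : d ≠ 0) :
    ∃ r : WKBPhase, r.Solves m σ En (Set.Ioi xp) ∧ Tendsto (r.mode ε) atTop (𝓝 0) ∧
      r.HasOverlapForm m ε xp (Set.Ioi xp) I d := by
  have hE0 := h.energy_pos hm
  have hmc := hm.differentiable.continuous
  have hMc := continuous_momentum (En := En) hmc
  -- The hyperbolic counterpart of the arcsine: with P² = m² - En one has P' = m m'/P, so log(m + P)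
  -- has derivative m'/P.
  set θ : ℝ → ℝ := fun x => Real.log (m x + momentum m En x)
  have hκ := overlapGain_pos hε (h.slope_right_ne hm)
  obtain ⟨β, hβ⟩ := exists_exp_I_mul_eq (D := d / (overlapGain m ε xp *
    cexp (-(I * σ / (2 * I) * θ xp)))) (div_ne_zero hd (mul_ne_zero (ofReal_ne_zero.2 hκ.ne')
      (exp_ne_zero _)))
  have hpos (x : ℝ) (hx : xp ≤ x) : 0 < m x + momentum m En x := by
    have h1 : √En ≤ m x := by rw [← h.map_right hm]; exact hm.strictMono.monotone hx
    have h2 := Real.sqrt_pos.2 hE0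
    have h3 : 0 ≤ momentum m En x := Real.sqrt_nonneg _
    linarith
  have hlim : Tendsto (momentum m En) atTop (𝓝 √|En - 1 ^ 2|) :=
    ((hm.tendsto_atTop.pow 2).const_sub En).abs.sqrt
  have hq1 : En - 1 ^ 2 ≠ 0 := by norm_num; linarith
  have hl : 0 < √|En - 1 ^ 2| := Real.sqrt_pos.2 (abs_pos.2 hq1)
  refine ⟨wkbPhase m σ En xp I θ β, ?_, ?_, ?_⟩
  · refine wkbPhase_solves hm.differentiable isOpen_Ioi I_ne_zero
      (fun x hx => (h.neg_of_gt hm hx).ne) (fun x hx => ?_) (fun x hx => ?_)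
    · rw [abs_of_neg (h.neg_of_gt hm hx), I_sq]; push_cast; ring
    · have hq := h.neg_of_gt hm hx
      have hM : 0 < momentum m En x := Real.sqrt_pos.2 (abs_pos.2 hq.ne)
      have hp := hpos x (le_of_lt hx)
      refine (((hm.differentiable x).hasDerivAt.add (hasDerivAt_momentum hm hq)).log
        hp.ne').congr_deriv ?_
      simp only [Pi.add_apply]
      field_simp
      ring
  · refine tendsto_wkbPhase_mode hε hm.tendsto_atTop hq1
      ((hm.tendsto_atTop.add hlim).log (by positivity)) ?_
    simpa using tendsto_integral_atTop_of_tendsto_pos hMc hl hlim xp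
  · have key := (wkbPhase m σ En xp I θ β).hasOverlapForm_of_eq (a := 0) (s := I) hε hmc
      (hm.differentiable xp) h.right (h.slope_right_ne hm) (U := Set.Ioi xp) (by simp)
      (g := fun x => cexp (I * β) * cexp (-(I * σ / (2 * I) * θ x)))
      (g₀ := cexp (I * β) * cexp (-(I * σ / (2 * I) * θ xp)))
      (fun x hx => ?_) (fun x hx => exp_I_mul_wkbPhase_S1 (h.neg_of_gt hm hx).ne) ?_
    · convert key using 1
      rw [hβ, mul_zero, zero_div, Complex.exp_zero]
      have := exp_ne_zero (-(I * σ / (2 * I) * θ xp))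
      have := ofReal_ne_zero.2 hκ.ne'
      field_simp
    · rw [abs_integral_momentum (le_of_lt hx), zero_add]
      rfl
    · have hθ : ContinuousAt θ xp :=
        ContinuousAt.log (by fun_prop) (hpos xp le_rfl).ne'
      have : ContinuousAt (fun x => cexp (I * β) * cexp (-(I * σ / (2 * I) * θ x))) xp := by
        fun_prop
      exact this.tendsto.mono_left nhdsWithin_le_nhds

/-- Existence of the decaying WKB function on the left forbidden region, with any nonzero
coefficient. -/
lemma exists_left (h : AreTurningPoints m En xm xp) (hm : IsMassProfile m) (hε : 0 < ε)
    (hE : En < 1) {d : ℂ} (hd : d ≠ 0) :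
    ∃ l : WKBPhase, l.Solves m σ En (Set.Iio xm) ∧ Tendsto (l.mode ε) atBot (𝓝 0) ∧
      l.HasOverlapForm m ε xm (Set.Iio xm) I d := by
  have hE0 := h.energy_pos hm
  have hmc := hm.differentiable.continuous
  have hMc := continuous_momentum (En := En) hmc
  set θ : ℝ → ℝ := fun x => -Real.log (-m x + momentum m En x)
  have hκ := overlapGain_pos hε (h.slope_left_ne hm)
  obtain ⟨β, hβ⟩ := exists_exp_I_mul_eq (D := d / (overlapGain m ε xm *
    cexp (-(I * σ / (2 * -I) * θ xm)))) (div_ne_zero hd (mul_ne_zero (ofReal_ne_zero.2 hκ.ne')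
      (exp_ne_zero _)))
  have hpos (x : ℝ) (hx : x ≤ xm) : 0 < -m x + momentum m En x := by
    have h1 : m x ≤ -√En := by rw [← h.map_left hm]; exact hm.strictMono.monotone hx
    have h2 := Real.sqrt_pos.2 hE0
    have h3 : 0 ≤ momentum m En x := Real.sqrt_nonneg _
    linarith
  have hlim : Tendsto (momentum m En) atBot (𝓝 √|En - (-1) ^ 2|) :=
    ((hm.tendsto_atBot.pow 2).const_sub En).abs.sqrt
  have hq1 : En - (-1) ^ 2 ≠ 0 := by norm_num; linarith
  have hl : 0 < √|En - (-1) ^ 2| := Real.sqrt_pos.2 (abs_pos.2 hq1)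
  -- The integral from `xm` is negative to the left of `xm`, so the constant -I gives decay away
  -- from the turning point.
  refine ⟨wkbPhase m σ En xm (-I) θ β, ?_, ?_, ?_⟩
  · refine wkbPhase_solves hm.differentiable isOpen_Iio (neg_ne_zero.2 I_ne_zero)
      (fun x hx => (h.neg_of_lt hm hx).ne) (fun x hx => ?_) (fun x hx => ?_)
    · rw [abs_of_neg (h.neg_of_lt hm hx), neg_sq, I_sq]; push_cast; ring
    · have hq := h.neg_of_lt hm hx
      have hM : 0 < momentum m En x := Real.sqrt_pos.2 (abs_pos.2 hq.ne)
      have hp := hpos x (le_of_lt hx)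
      refine (((hm.differentiable x).hasDerivAt.neg.add (hasDerivAt_momentum hm hq)).log
        hp.ne').neg.congr_deriv ?_
      simp only [Pi.add_apply, Pi.neg_apply]
      field_simp
      ring
  · refine tendsto_wkbPhase_mode hε hm.tendsto_atBot hq1
      ((hm.tendsto_atBot.neg.add hlim).log (by positivity)).neg ?_
    have h1 := (tendsto_integral_atTop_of_tendsto_pos (g := fun t => momentum m En (-t))
      (by fun_prop) hl (hlim.comp tendsto_neg_atTop_atBot) (-xm)).comp tendsto_neg_atBot_atTop
    refine (tendsto_neg_atTop_atBot.comp h1).congr fun x => ?_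
    simp only [Function.comp_apply]
    rw [intervalIntegral.integral_comp_neg (momentum m En), neg_neg, neg_neg,
      intervalIntegral.integral_symm]
    simp
  · have key := (wkbPhase m σ En xm (-I) θ β).hasOverlapForm_of_eq (a := 0) (s := I) hε hmc
      (hm.differentiable xm) h.left (h.slope_left_ne hm) (U := Set.Iio xm) (by simp)
      (g := fun x => cexp (I * β) * cexp (-(I * σ / (2 * -I) * θ x)))
      (g₀ := cexp (I * β) * cexp (-(I * σ / (2 * -I) * θ xm)))
      (fun x hx => ?_) (fun x hx => exp_I_mul_wkbPhase_S1 (h.neg_of_lt hm hx).ne) ?_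
    · convert key using 1
      rw [hβ, mul_zero, zero_div, Complex.exp_zero]
      have := exp_ne_zero (-(I * σ / (2 * -I) * θ xm))
      have := ofReal_ne_zero.2 hκ.ne'
      field_simp
    · rw [abs_integral_momentum_symm (le_of_lt hx), zero_add]
      simp only [wkbPhase]
      rw [intervalIntegral.integral_symm]
      push_cast
      ring
    · have hθ : ContinuousAt θ xm :=
        (ContinuousAt.log (f := fun x => -m x + momentum m En x) (by fun_prop)
          (hpos xm le_rfl).ne').neg
      have : ContinuousAt (fun x => cexp (I * β) * cexp (-(I * σ / (2 * -I) * θ x))) xm := by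
        fun_prop
      exact this.tendsto.mono_left nhdsWithin_le_nhds

lemma accumulatedPhase_eq (h : AreTurningPoints m En xm xp) (hm : IsMassProfile m) :
    accumulatedPhase m ε En xm xp = (∫ t in xm..xp, momentum m En t) / ε := by
  rw [accumulatedPhase, one_div_mul_eq_div]
  congr 1
  refine intervalIntegral.integral_congr_ae (Eventually.of_forall fun t ht => ?_)
  rw [Set.uIoc_of_le h.lt.le] at ht
  have : 0 ≤ En - m t ^ 2 := by
    rcases ht.2.eq_or_lt with rfl | h2
    · rw [h.right, sub_self]
    · exact (h.pos_of_mem hm ⟨ht.1, h2⟩).le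
  simp only [momentum]
  rw [abs_of_nonneg this]

/-! ### WKB waves on the allowed interval -/

section Allowed

variable {τ : ℝ}

/-- The arcsine equals -π/2 at the left turning point, and 1/τ = τ. -/
lemma tendsto_factor_left (h : AreTurningPoints m En xm xp) (hm : IsMassProfile m)
    (hτ : τ = 1 ∨ τ = -1) (D : ℂ) :
    Tendsto (fun x => D * cexp (-(I * σ / (2 * τ) * Real.arcsin (m x / √En))))
      (𝓝[Set.Ioo xm xp] xm) (𝓝 (D * cexp (σ * τ * (Real.pi / 4) * I))) := by
  have hs := Real.sqrt_pos.2 (h.energy_pos hm)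
  have hmc := hm.differentiable.continuous
  have hc : Continuous fun x => D * cexp (-(I * σ / (2 * τ) * Real.arcsin (m x / √En))) := by
    have := Real.continuous_arcsin
    fun_prop
  have h1 := hc.tendsto xm
  rw [h.map_left hm, neg_div, div_self hs.ne', Real.arcsin_neg_one] at h1
  convert h1.mono_left nhdsWithin_le_nhds using 5
  rcases hτ with rfl | rfl <;> push_cast <;> ring

lemma tendsto_factor_right (h : AreTurningPoints m En xm xp) (hm : IsMassProfile m)
    (hτ : τ = 1 ∨ τ = -1) (D : ℂ) :
    Tendsto (fun x => D * cexp (-(I * σ / (2 * τ) * Real.arcsin (m x / √En))))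
      (𝓝[Set.Ioo xm xp] xp) (𝓝 (D * cexp (-(σ * τ * (Real.pi / 4) * I)))) := by
  have hs := Real.sqrt_pos.2 (h.energy_pos hm)
  have hmc := hm.differentiable.continuous
  have hc : Continuous fun x => D * cexp (-(I * σ / (2 * τ) * Real.arcsin (m x / √En))) := by
    have := Real.continuous_arcsin
    fun_prop
  have h1 := hc.tendsto xp
  rw [h.map_right hm, div_self hs.ne', Real.arcsin_one] at h1
  convert h1.mono_left nhdsWithin_le_nhds using 5
  rcases hτ with rfl | rfl <;> push_cast <;> ring

/-- Existence of the WKB functions on the allowed region, with any nonzero amplitude. -/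
lemma exists_allowed (h : AreTurningPoints m En xm xp) (hm : IsMassProfile m) (hε : 0 < ε)
    (hτ : τ = 1 ∨ τ = -1) {D : ℂ} (hD : D ≠ 0) :
    ∃ p : WKBPhase, p.Solves m σ En (Set.Ioo xm xp) ∧
      (∀ x ∈ Set.Ioo xm xp, deriv p.S0 x = τ * momentum m En x) ∧
      p.HasOverlapForm m ε xm (Set.Ioo xm xp) τ
        (D * overlapGain m ε xm * cexp (σ * τ * (Real.pi / 4) * I)) ∧
      p.HasOverlapForm m ε xp (Set.Ioo xm xp) (-τ)
        (D * overlapGain m ε xp * cexp (accumulatedPhase m ε En xm xp * τ * I)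
          * cexp (-(σ * τ * (Real.pi / 4) * I))) := by
  have hmc := hm.differentiable.continuous
  have hMc := continuous_momentum (En := En) hmc
  have hτ0 : (τ : ℂ) ≠ 0 := by rcases hτ with rfl | rfl <;> simp
  obtain ⟨β, hβ⟩ := exists_exp_I_mul_eq hD
  set θ : ℝ → ℝ := fun x => Real.arcsin (m x / √En)
  have hS1 (x : ℝ) (hx : x ∈ Set.Ioo xm xp) :=
    exp_I_mul_wkbPhase_S1 (σ := σ) (x₀ := xm) (c := τ) (β := β) (θ := θ)
      (h.pos_of_mem hm hx).ne'
  rw [hβ] at hS1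
  refine ⟨wkbPhase m σ En xm τ θ β, ?_, fun x _ => by rw [deriv_wkbPhase_S0 hmc], ?_, ?_⟩
  · refine wkbPhase_solves hm.differentiable isOpen_Ioo hτ0
      (fun x hx => (h.pos_of_mem hm hx).ne') (fun x hx => ?_)
      (fun x hx => h.hasDerivAt_arcsin hm hx)
    rw [abs_of_pos (h.pos_of_mem hm hx)]
    rcases hτ with rfl | rfl <;> simp
  · convert WKBPhase.hasOverlapForm_of_eq (a := 0) (s := τ) hε hmc (hm.differentiable xm) h.left
      (h.slope_left_ne hm) (by simp) (fun x hx => ?_) hS1 (h.tendsto_factor_left hm hτ D) using 1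
    · rw [mul_zero, zero_div, Complex.exp_zero]
      ring
    · rw [abs_integral_momentum hx.1.le, zero_add]
      rfl
  · convert WKBPhase.hasOverlapForm_of_eq (a := τ * (∫ t in xm..xp, momentum m En t : ℝ)) (s := -τ)
      hε hmc (hm.differentiable xp) h.right
      (h.slope_right_ne hm) (by simp) (fun x hx => ?_) hS1 (h.tendsto_factor_right hm hτ D) using 1
    · rw [h.accumulatedPhase_eq hm, ofReal_div, show I * (τ * (∫ t in xm..xp, momentum m En t : ℝ)) / ε
        = (∫ t in xm..xp, momentum m En t : ℝ) / ε * τ * I by ring]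
      ring
    · rw [abs_integral_momentum_symm hx.2.le,
        ← intervalIntegral.integral_add_adjacent_intervals (hMc.intervalIntegrable xm x)
        (hMc.intervalIntegrable x xp)]
      simp only [wkbPhase]
      push_cast
      ring

/-- The coefficients of a WKB function at the two turning points determine each other. -/
lemma allowed_coeffs (h : AreTurningPoints m En xm xp) (hm : IsMassProfile m) (hε : 0 < ε)
    (hτ : τ = 1 ∨ τ = -1) {p : WKBPhase} (hp : p.Solves m σ En (Set.Ioo xm xp))
    (hd : ∀ x ∈ Set.Ioo xm xp, deriv p.S0 x = τ * momentum m En x) {s s' d d' : ℂ}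
    (h₁ : p.HasOverlapForm m ε xm (Set.Ioo xm xp) s d)
    (h₂ : p.HasOverlapForm m ε xp (Set.Ioo xm xp) s' d') :
    ∃ D : ℂ, D ≠ 0 ∧ d = D * overlapGain m ε xm * cexp (σ * τ * (Real.pi / 4) * I) ∧
      d' = D * overlapGain m ε xp * cexp (accumulatedPhase m ε En xm xp * τ * I)
          * cexp (-(σ * τ * (Real.pi / 4) * I)) := by
  have hmc := hm.differentiable.continuous
  have hMc := continuous_momentum (En := En) hmc
  have hτ0 : (τ : ℂ) ≠ 0 := by rcases hτ with rfl | rfl <;> simp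
  obtain ⟨x₁, hx₁⟩ : (Set.Ioo xm xp).Nonempty := Set.nonempty_Ioo.2 h.lt
  set θ : ℝ → ℝ := fun x => Real.arcsin (m x / √En)
  -- T is i S₁ minus the explicit antiderivative given by the transport equation, hence constant;
  -- exp(T) is the free amplitude.
  set T : ℝ → ℂ := fun x =>
    I * p.S1 x + (Real.log (En - m x ^ 2) : ℝ) / 4 + I * σ / (2 * τ) * θ x with hT
  have hTd : ∀ x ∈ Set.Ioo xm xp, HasDerivAt T 0 x := by
    intro x hx
    have hq := h.pos_of_mem hm hx
    have hlog : HasDerivAt (fun y => Real.log (En - m y ^ 2))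
        (-(2 * (m x * deriv m x)) / (En - m x ^ 2)) x := by
      refine HasDerivAt.log ?_ hq.ne'
      exact (((hm.differentiable x).hasDerivAt.pow 2).const_sub En).congr_deriv (by simp; ring)
    refine ((((hp.diff_S1 x hx).hasDerivAt.const_mul I).add (hlog.ofReal_comp.div_const 4)).add
      ((h.hasDerivAt_arcsin hm hx).ofReal_comp.const_mul _)).congr_deriv ?_
    rw [hp.I_mul_deriv_S1 hm.differentiable isOpen_Ioo hx hq.ne', hd x hx]
    have hM : (momentum m En x : ℂ) ≠ 0 :=
      ofReal_ne_zero.2 (Real.sqrt_pos.2 (abs_pos.2 hq.ne')).ne'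
    have hq' : ((En : ℂ) - m x ^ 2) ≠ 0 := by exact_mod_cast hq.ne'
    push_cast
    field_simp
    ring
  have hS1 : ∀ x ∈ Set.Ioo xm xp, cexp (I * p.S1 x) = ((|En - m x ^ 2| ^ (1 / 4 : ℝ))⁻¹ : ℝ)
      * (cexp (T x₁) * cexp (-(I * σ / (2 * τ) * θ x))) := by
    intro x hx
    rw [eq_of_hasDerivAt_zero_of_Ioo hTd hx₁ hx, ofReal_inv,
      ← exp_log_div_four (h.pos_of_mem hm hx).ne', ← Complex.exp_neg, ← Complex.exp_add,
      ← Complex.exp_add, hT]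
    congr 1
    ring
  have hS0 : ∀ x ∈ Set.Ioo xm xp, p.S0 x = p.S0 x₁ - τ * (∫ t in xm..x₁, momentum m En t : ℝ)
      + τ * (∫ t in xm..x, momentum m En t : ℝ) := by
    intro x hx
    have := eq_of_hasDerivAt_zero_of_Ioo
      (f := fun x => p.S0 x - τ * (∫ t in xm..x, momentum m En t : ℝ)) (fun y hy => by
        refine ((hp.diff_S0 y hy).hasDerivAt.sub (((hMc.integral_hasStrictDerivAt xm
          y).hasDerivAt.ofReal_comp).const_mul (τ : ℂ))).congr_deriv ?_
        rw [hd y hy, sub_self]) hx hx₁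
    linear_combination this
  set A := p.S0 x₁ - τ * (∫ t in xm..x₁, momentum m En t : ℝ)
  have hlim (x₂ : ℝ) : Tendsto p.S0 (𝓝[Set.Ioo xm xp] x₂)
      (𝓝 (A + τ * (∫ t in xm..x₂, momentum m En t : ℝ))) := by
    have hc : Continuous fun x => A + τ * ((∫ t in xm..x, momentum m En t : ℝ) : ℂ) := by
      have : Continuous fun x => ∫ t in xm..x, momentum m En t := by
        exact intervalIntegral.continuous_primitive (fun a b => hMc.intervalIntegrable a b) xm
      fun_prop
    refine ((hc.tendsto x₂).mono_left nhdsWithin_le_nhds).congr' ?_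
    filter_upwards [self_mem_nhdsWithin] with x hx using (hS0 x hx).symm
  have hne₁ : (𝓝[Set.Ioo xm xp] xm).NeBot := by
    rw [← mem_closure_iff_nhdsWithin_neBot, closure_Ioo h.lt.ne]
    exact ⟨le_rfl, h.lt.le⟩
  have hne₂ : (𝓝[Set.Ioo xm xp] xp).NeBot := by
    rw [← mem_closure_iff_nhdsWithin_neBot, closure_Ioo h.lt.ne]
    exact ⟨h.lt.le, le_rfl⟩
  obtain ⟨a₁, ha₁, rfl⟩ := h₁.exists_coeff hε (hm.differentiable xm) h.left (h.slope_left_ne hm)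
    (by simp) hne₁ hS1 (h.tendsto_factor_left hm hτ _)
  obtain ⟨a₂, ha₂, rfl⟩ := h₂.exists_coeff hε (hm.differentiable xp) h.right (h.slope_right_ne hm)
    (by simp) hne₂ hS1 (h.tendsto_factor_right hm hτ _)
  obtain rfl := tendsto_nhds_unique ha₁ (hlim xm)
  obtain rfl := tendsto_nhds_unique ha₂ (hlim xp)
  refine ⟨cexp (I * A / ε) * cexp (T x₁), mul_ne_zero (exp_ne_zero _) (exp_ne_zero _), ?_, ?_⟩
  · rw [intervalIntegral.integral_same, ofReal_zero, mul_zero, add_zero]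
    ring
  · rw [mul_add, add_div, Complex.exp_add, h.accumulatedPhase_eq hm, ofReal_div,
      show I * (τ * (∫ t in xm..xp, momentum m En t : ℝ)) / ε
        = (∫ t in xm..xp, momentum m En t : ℝ) / ε * τ * I by ring]
    ring

end Allowed

end AreTurningPoints

/-! ### Estimates behind the quantisation condition -/

/-- On a fixed neighbourhood of 0 one has |m| < √a/2. For every En ≥ a it lies between the turning
points, and the momentum is at least √a/2 on it. -/
lemma exists_integral_momentum_ge {m : ℝ → ℝ} (hm : IsMassProfile m) {a : ℝ} (ha : 0 < a) :
    ∃ c₀ > 0, ∀ En xm xp : ℝ, a ≤ En → AreTurningPoints m En xm xp →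
      c₀ ≤ ∫ t in xm..xp, momentum m En t := by
  have hs : 0 < √a := Real.sqrt_pos.2 ha
  have hmc := hm.differentiable.continuous
  obtain ⟨δ, hδ, hball⟩ := Metric.continuousAt_iff.1 hmc.continuousAt (√a / 2) (half_pos hs)
  have hsmall : ∀ x, |x| ≤ δ / 2 → |m x| < √a / 2 := by
    intro x hx
    have := hball (x := x) (by rw [Real.dist_eq, sub_zero]; linarith)
    rwa [hm.map_zero, Real.dist_eq, sub_zero] at this
  refine ⟨δ * (√a / 2), by positivity, fun En xm xp hE h => ?_⟩
  have hMc := continuous_momentum (En := En) hmc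
  have hsE : √a ≤ √En := Real.sqrt_le_sqrt hE
  have hleft : xm ≤ -(δ / 2) := by
    have := hsmall (-(δ / 2)) (by rw [abs_neg, abs_of_pos (by positivity)])
    refine (hm.strictMono.lt_iff_lt.1 ?_).le
    rw [h.map_left hm]
    linarith [(abs_lt.1 this).1]
  have hright : δ / 2 ≤ xp := by
    have := hsmall (δ / 2) (by rw [abs_of_pos (by positivity)])
    refine (hm.strictMono.lt_iff_lt.1 ?_).le
    rw [h.map_right hm]
    linarith [(abs_lt.1 this).2]
  have hmid : ∫ _ in (-(δ / 2))..(δ / 2), √a / 2 ≤ ∫ t in (-(δ / 2))..(δ / 2), momentum m En t := by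
    refine intervalIntegral.integral_mono_on (by linarith) (by simp)
      (hMc.intervalIntegrable _ _) fun t ht => ?_
    have h1 := hsmall t (abs_le.2 ht)
    have h2 : m t ^ 2 ≤ (√a / 2) ^ 2 := sq_le_sq' (by linarith [(abs_lt.1 h1).1])
      (abs_lt.1 h1).2.le
    refine Real.le_sqrt_of_sq_le (le_trans ?_ (le_abs_self _))
    have h3 := Real.sq_sqrt ha.le
    nlinarith
  rw [intervalIntegral.integral_const, smul_eq_mul] at hmid
  have hmono : ∫ t in (-(δ / 2))..(δ / 2), momentum m En t ≤ ∫ t in xm..xp, momentum m En t :=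
    intervalIntegral.integral_mono_interval hleft (by linarith) hright
      (Eventually.of_forall fun t => momentum_nonneg t) (hMc.intervalIntegrable _ _)
  linarith

/-- The left side is 2|sin Φ|. With nπ the nearest multiple of π, Jordan's inequality bounds the
distance by (π/2)·3η < 5η when η > 0. -/
lemma exists_int_abs_sub_mul_pi_le {Φ η : ℝ}
    (h : ‖cexp (I * ((2 * Φ : ℝ) : ℂ)) - 1‖ ≤ 6 * η) :
    ∃ n : ℤ, |Φ - n * Real.pi| ≤ Real.pi / 2 ∧ |Φ - n * Real.pi| ≤ 5 * η := by
  have hpi := Real.pi_pos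
  refine ⟨round (Φ / Real.pi), ?_⟩
  set n := round (Φ / Real.pi)
  have h1 : |Φ - n * Real.pi| ≤ Real.pi / 2 := by
    have := abs_sub_round (Φ / Real.pi)
    have e : Φ - n * Real.pi = (Φ / Real.pi - n) * Real.pi := by field_simp
    rw [e, abs_mul, abs_of_pos hpi]
    calc _ ≤ 1 / 2 * Real.pi := by gcongr
      _ = _ := by ring
  refine ⟨h1, ?_⟩
  rw [norm_exp_I_mul_ofReal_sub_one, mul_div_cancel_left₀ _ two_ne_zero, norm_mul,
    Real.norm_eq_abs, Real.norm_eq_abs, abs_two] at h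
  have h2 : |Real.sin (Φ - n * Real.pi)| = |Real.sin Φ| := by
    rw [Real.sin_sub_int_mul_pi, abs_mul, abs_zpow, abs_neg, abs_one, one_zpow, one_mul]
  have h3 := Real.mul_le_sin (abs_nonneg (Φ - n * Real.pi)) h1
  rw [← Real.abs_sin_eq_sin_abs_of_abs_le_pi (by linarith), h2, div_mul_eq_mul_div,
    div_le_iff₀ hpi] at h3
  have h4 := Real.pi_lt_d2
  nlinarith [abs_nonneg (Real.sin Φ)]

lemma airyPlus_sq : airyPlus ^ 2 = -airyMinus ^ 2 := by
  have h : cexp (-(Real.pi / 4 * I)) ^ 2 = -cexp (Real.pi / 4 * I) ^ 2 := by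
    rw [← Complex.exp_nat_mul, ← Complex.exp_nat_mul,
      show ((2 : ℕ) : ℂ) * -(Real.pi / 4 * I) = -(Real.pi / 2 * I) by push_cast; ring,
      show ((2 : ℕ) : ℂ) * (Real.pi / 4 * I) = Real.pi / 2 * I by push_cast; ring,
      Complex.exp_neg, exp_pi_div_two_mul_I, inv_I]
  rw [airyPlus, airyMinus, mul_pow, mul_pow, h, mul_neg]

lemma airyPlus_ne_zero : airyPlus ≠ 0 :=
  mul_ne_zero (ofReal_ne_zero.2 (Real.sqrt_pos.2 Real.pi_pos).ne') (exp_ne_zero _)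

lemma airyMinus_ne_zero : airyMinus ≠ 0 :=
  mul_ne_zero (ofReal_ne_zero.2 (Real.sqrt_pos.2 Real.pi_pos).ne') (exp_ne_zero _)

/-- The factor `exp (i σ π / 4)` acquired from the transport equation. -/
lemma exp_quarter_pow_four {σ : ℤ} (hσ : σ = 1 ∨ σ = -1) :
    cexp (σ * (Real.pi / 4) * I) ^ 4 = -1 := by
  rw [← Complex.exp_nat_mul]
  rcases hσ with rfl | rfl
  · rw [← exp_pi_mul_I]; congr 1; push_cast; ring
  · rw [show ((4 : ℕ) : ℂ) * (((-1 : ℤ) : ℂ) * (Real.pi / 4) * I) = -(Real.pi * I) by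
      push_cast; ring, Complex.exp_neg, exp_pi_mul_I]
    norm_num

/-- Written as factors close to 1, the mismatches survive when the matching conditions are
multiplied and the amplitudes cancel. -/
lemma exists_ratio_of_norm_sub_le {c d : ℂ} {η : ℝ} (hd : d ≠ 0) (h : ‖d - c‖ ≤ η * ‖c‖) :
    c ≠ 0 ∧ ∃ r, d = c * r ∧ ‖r - 1‖ ≤ η := by
  have hc : c ≠ 0 := by
    rintro rfl
    rw [sub_zero, norm_zero, mul_zero] at h
    exact hd (norm_le_zero_iff.1 h)
  refine ⟨hc, d / c, by field_simp, ?_⟩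
  rwa [div_sub_one hc, norm_div, div_le_iff₀ (norm_pos_iff.2 hc)]

lemma norm_mul_sub_one_le {r s : ℂ} {η : ℝ} (hη : η ≤ 1) (hr : ‖r - 1‖ ≤ η) (hs : ‖s - 1‖ ≤ η) :
    ‖r * s - 1‖ ≤ 3 * η := by
  have e : r * s - 1 = (r - 1) * (s - 1) + (r - 1) + (s - 1) := by ring
  have h0 := norm_nonneg (r - 1)
  have h1 : ‖(r - 1) * (s - 1)‖ ≤ η := by
    rw [norm_mul]
    nlinarith [norm_nonneg (s - 1)]
  rw [e]
  linarith [norm_add₃_le (a := (r - 1) * (s - 1)) (b := r - 1) (c := s - 1)]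

/-! ### Global consistency versus the accumulated phase -/

section Consistency

variable {m : ℝ → ℝ} {σ : ℤ} {ε En xm xp : ℝ}

lemma WKBPhase.Solves.deriv_S0_eq {U : Set ℝ} {p : WKBPhase} (hp : p.Solves m σ En U) {x : ℝ}
    (hx : x ∈ U) (hq : 0 < En - m x ^ 2) :
    deriv p.S0 x = momentum m En x ∨ deriv p.S0 x = -(momentum m En x : ℂ) := by
  refine sq_eq_sq_iff_eq_or_eq_neg.1 ?_
  rw [hp.eikonal x hx, ← ofReal_pow, momentum_sq, abs_of_pos hq]

lemma WKBPhase.Solves.deriv_S0_eq_of_re_pos {U : Set ℝ} {p : WKBPhase} (hp : p.Solves m σ En U)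
    {x : ℝ} (hx : x ∈ U) (hq : 0 < En - m x ^ 2) (hre : 0 < (deriv p.S0 x).re) :
    deriv p.S0 x = momentum m En x := by
  refine (hp.deriv_S0_eq hx hq).resolve_right fun h => ?_
  rw [h, neg_re, ofReal_re] at hre
  linarith [momentum_nonneg (m := m) (En := En) x]

lemma WKBPhase.Solves.deriv_S0_eq_of_re_neg {U : Set ℝ} {p : WKBPhase} (hp : p.Solves m σ En U)
    {x : ℝ} (hx : x ∈ U) (hq : 0 < En - m x ^ 2) (hre : (deriv p.S0 x).re < 0) :
    deriv p.S0 x = -(momentum m En x : ℂ) := by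
  refine (hp.deriv_S0_eq hx hq).resolve_left fun h => ?_
  rw [h, ofReal_re] at hre
  linarith [momentum_nonneg (m := m) (En := En) x]

/-- Global consistency forces the quantisation of the accumulated phase. -/
lemma GloballyConsistent.norm_exp_sub_one_le {η : ℝ} (hη : η ≤ 1)
    (hc : GloballyConsistent m σ ε En xm xp η) (hm : IsMassProfile m) (hσ : σ = 1 ∨ σ = -1)
    (hε : 0 < ε) (h : AreTurningPoints m En xm xp) :
    ‖cexp (I * ((2 * accumulatedPhase m ε En xm xp : ℝ) : ℂ)) - 1‖ ≤ 6 * η := by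
  obtain ⟨l, R, L, r, -, -, -, -, hR, hRre, hL, hLre,
    ⟨φ, c, cp, cm, dp, dm, hφ, hF, hA, -, hRm, hLm, hdp, hdm⟩,
    ⟨φ', c', cp', cm', dp', dm', hφ', hF', hA', -, hLp, hRp, hdp', hdm'⟩⟩ := hc
  obtain ⟨t, rfl, rfl⟩ := hφ.connection hF hA
  obtain ⟨t', rfl, rfl⟩ := hφ'.connection hF' hA'
  obtain ⟨D, hD, rfl, rfl⟩ := h.allowed_coeffs (τ := 1) hm hε (Or.inl rfl) hR (fun x hx => by
    rw [hR.deriv_S0_eq_of_re_pos hx (h.pos_of_mem hm hx) (hRre x hx)]; simp) hRm hRp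
  obtain ⟨D', hD', rfl, rfl⟩ := h.allowed_coeffs (τ := -1) hm hε (Or.inr rfl) hL (fun x hx => by
    rw [hL.deriv_S0_eq_of_re_neg hx (h.pos_of_mem hm hx) (hLre x hx)]; simp) hLm hLp
  have hκm : (overlapGain m ε xm : ℂ) ≠ 0 :=
    ofReal_ne_zero.2 (overlapGain_pos hε (h.slope_left_ne hm)).ne'
  have hκp : (overlapGain m ε xp : ℂ) ≠ 0 :=
    ofReal_ne_zero.2 (overlapGain_pos hε (h.slope_right_ne hm)).ne'
  have hu4 := exp_quarter_pow_four hσ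
  have hP := airyPlus_sq
  have hN := airyMinus_ne_zero
  have hnorm : ‖cexp (I * ((2 * accumulatedPhase m ε En xm xp : ℝ) : ℂ))‖ = 1 :=
    norm_exp_I_mul_ofReal _
  have he2 : cexp (I * ((2 * accumulatedPhase m ε En xm xp : ℝ) : ℂ))
      = cexp (accumulatedPhase m ε En xm xp * I) ^ 2 := by
    rw [← Complex.exp_nat_mul]; congr 1; push_cast; ring
  rw [he2] at hnorm ⊢
  have hu : cexp (σ * (Real.pi / 4) * I) ≠ 0 := exp_ne_zero _
  have he : cexp (accumulatedPhase m ε En xm xp * I) ≠ 0 := exp_ne_zero _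
  simp only [ofReal_one, ofReal_neg, mul_one, mul_neg, neg_mul, neg_neg, Complex.exp_neg]
    at hdp hdm hdp' hdm'
  generalize cexp (σ * (Real.pi / 4) * I) = u at *
  generalize cexp (accumulatedPhase m ε En xm xp * I) = e at *
  obtain ⟨hc1, r₁, h₁, hr₁⟩ := exists_ratio_of_norm_sub_le (by simp [hD, hκm, hu]) hdp
  obtain ⟨hc2, r₂, h₂, hr₂⟩ := exists_ratio_of_norm_sub_le (by simp [hD', hκm, hu]) hdm
  obtain ⟨hc3, r₃, h₃, hr₃⟩ := exists_ratio_of_norm_sub_le (by simp [hD', hκp, hu, he]) hdp'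
  obtain ⟨hc4, r₄, h₄, hr₄⟩ := exists_ratio_of_norm_sub_le (by simp [hD, hκp, hu, he]) hdm'
  have ht := left_ne_zero_of_mul hc1
  have ht' := left_ne_zero_of_mul hc3
  -- The product of the two incoming coefficients is compared with that of the two outgoing ones.
  -- The sign from u⁴ = -1 cancels the sign from the squared Airy ratio.
  have key : r₂ * r₄ = e ^ 2 * (r₁ * r₃) := by
    have h5 : (t * airyMinus * r₂) * (t' * airyMinus * r₄) * u ^ 4
        = e ^ 2 * ((t * airyPlus * r₁) * (t' * airyPlus * r₃)) := by
      rw [← h₁, ← h₂, ← h₃, ← h₄]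
      field_simp
    have h6 : t * t' * airyMinus ^ 2 * (r₂ * r₄ - e ^ 2 * (r₁ * r₃)) = 0 := by
      rw [hu4] at h5
      linear_combination -h5 - (e ^ 2 * t * t' * r₁ * r₃) * hP
    exact sub_eq_zero.1 ((mul_eq_zero.1 h6).resolve_left (by simp [ht, ht', hN]))
  have e1 : e ^ 2 - 1 = (r₂ * r₄ - 1) - e ^ 2 * (r₁ * r₃ - 1) := by rw [key]; ring
  rw [e1]
  refine (norm_sub_le _ _).trans ?_
  rw [norm_mul, hnorm, one_mul]
  linarith [norm_mul_sub_one_le hη hr₂ hr₄, norm_mul_sub_one_le hη hr₁ hr₃]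

/-- Near a quantised accumulated phase the WKB functions can be matched at both turning points. -/
lemma globallyConsistent_of_norm_exp_sub_one_le {η : ℝ} (hm : IsMassProfile m)
    (hσ : σ = 1 ∨ σ = -1) (hε : 0 < ε) (hE : En < 1) (h : AreTurningPoints m En xm xp)
    (hη : ‖cexp (I * ((2 * accumulatedPhase m ε En xm xp : ℝ) : ℂ)) - 1‖ ≤ η) :
    GloballyConsistent m σ ε En xm xp η := by
  have hκm : (overlapGain m ε xm : ℂ) ≠ 0 :=
    ofReal_ne_zero.2 (overlapGain_pos hε (h.slope_left_ne hm)).ne'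
  have hκp : (overlapGain m ε xp : ℂ) ≠ 0 :=
    ofReal_ne_zero.2 (overlapGain_pos hε (h.slope_right_ne hm)).ne'
  have hu4 := exp_quarter_pow_four hσ
  have hP2 := airyPlus_sq
  have hN := airyMinus_ne_zero
  have hP := airyPlus_ne_zero
  have hpi : (√Real.pi : ℂ) ≠ 0 := ofReal_ne_zero.2 (Real.sqrt_pos.2 Real.pi_pos).ne'
  have he2 : cexp (I * ((2 * accumulatedPhase m ε En xm xp : ℝ) : ℂ))
      = cexp (accumulatedPhase m ε En xm xp * I) ^ 2 := by
    rw [← Complex.exp_nat_mul]; congr 1; push_cast; ring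
  have hη0 : 0 ≤ η := (norm_nonneg _).trans hη
  rw [he2] at hη
  have hu : cexp (σ * (Real.pi / 4) * I) ≠ 0 := exp_ne_zero _
  have he : cexp (accumulatedPhase m ε En xm xp * I) ≠ 0 := exp_ne_zero _
  obtain ⟨R, hR, hR0, hRm, hRp⟩ := h.exists_allowed (σ := σ) (τ := 1) hm hε (Or.inl rfl)
    -- The amplitudes of R and L are chosen to match `airySol` exactly at the left turning point.
    (D := airyPlus / (overlapGain m ε xm * cexp (σ * (Real.pi / 4) * I)))
    (div_ne_zero hP (mul_ne_zero hκm hu))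
  obtain ⟨L, hL, hL0, hLm, hLp⟩ := h.exists_allowed (σ := σ) (τ := -1) hm hε (Or.inr rfl)
    (D := airyMinus * cexp (σ * (Real.pi / 4) * I) / overlapGain m ε xm)
    (div_ne_zero (mul_ne_zero hN hu) hκm)
  simp only [ofReal_one, ofReal_neg, mul_one, mul_neg, neg_mul, neg_neg, Complex.exp_neg]
    at hRm hRp hLm hLp
  generalize cexp (σ * (Real.pi / 4) * I) = u at *
  generalize cexp (accumulatedPhase m ε En xm xp * I) = e at *
  -- With this multiple of `airySol` at the right turning point L matches exactly there as well, so
  -- the whole mismatch falls on R.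
  set t := airyMinus * u / overlapGain m ε xm * overlapGain m ε xp * e⁻¹ * u / airyPlus with htdef
  have ht : t ≠ 0 := by
    rw [htdef]
    simp [hN, hP, hu, hκm, hκp, he]
  obtain ⟨l, hl, hl0, hlm⟩ := h.exists_left (σ := σ) hm hε hE hpi
  obtain ⟨r, hr, hr0, hrp⟩ := h.exists_right (σ := σ) hm hε hE (mul_ne_zero ht hpi)
  have hMpos : ∀ x ∈ Set.Ioo xm xp, 0 < momentum m En x := fun x hx =>
    Real.sqrt_pos.2 (abs_pos.2 (h.pos_of_mem hm hx).ne')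
  refine ⟨l, R, L, r, hl, hl0, hr, hr0, hR, fun x hx => ?_, hL, fun x hx => ?_,
    ⟨airySol, _, _, _, _, _, isAirySolution_airySol, hasForbiddenForm_airySol,
      hasAllowedForm_airySol, hlm, hRm, hLm, ?_, ?_⟩,
    ⟨fun ζ => t * airySol ζ, _, _, _, _, _, isAirySolution_airySol.const_mul t,
      hasForbiddenForm_airySol.const_mul t, hasAllowedForm_airySol.const_mul t, hrp, hLp, hRp,
      ?_, ?_⟩⟩
  · rw [hR0 x hx]
    simpa using hMpos x hx
  · rw [hL0 x hx]
    simpa using hMpos x hx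
  · rw [show airyPlus / (overlapGain m ε xm * u) * overlapGain m ε xm * u = airyPlus by
      field_simp, sub_self, norm_zero]
    positivity
  · rw [show airyMinus * u / overlapGain m ε xm * overlapGain m ε xm * u⁻¹ = airyMinus by
      field_simp, sub_self, norm_zero]
    positivity
  · rw [htdef, div_mul_cancel₀ _ hP, sub_self, norm_zero]
    positivity
  · have e1 : airyPlus / (overlapGain m ε xm * u) * overlapGain m ε xp * e * u⁻¹
        = t * airyMinus * e ^ 2 := by
      rw [htdef]
      field_simp
      rw [hu4, hP2]
      ring
    rw [e1, show t * airyMinus * e ^ 2 - t * airyMinus = (e ^ 2 - 1) * (t * airyMinus) by ring,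
      norm_mul]
    gcongr

end Consistency

theorem theorem5p1 (m : ℝ → ℝ) (hm : IsMassProfile m) (σ : ℤ) (hσ : σ = 1 ∨ σ = -1)
    (a : ℝ) (ha : 0 < a) (K : ℝ) (hK : 0 < K) :
    ∃ C > 0, ∃ ε₀ > 0, ∀ ε En xm xp : ℝ,
      0 < ε → ε < ε₀ → a ≤ En → En < 1 → AreTurningPoints m En xm xp →
        (GloballyConsistent m σ ε En xm xp (K * ε) →
          ∃ k : ℕ,
            |accumulatedPhase m ε En xm xp - (k + ((σ : ℝ) + 1) / 2) * Real.pi| ≤ C * ε ∧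
            (σ = -1 → |accumulatedPhase m ε En xm xp - k * Real.pi| ≤ C * ε) ∧
            (σ = 1 → |accumulatedPhase m ε En xm xp - (k + 1) * Real.pi| ≤ C * ε)) ∧
        ((∃ k : ℕ,
            |accumulatedPhase m ε En xm xp - (k + ((σ : ℝ) + 1) / 2) * Real.pi| ≤ K * ε) →
          GloballyConsistent m σ ε En xm xp (C * ε)) := by
  obtain ⟨c₀, hc₀, hlow⟩ := exists_integral_momentum_ge hm ha
  -- The bound 1/K keeps the relative error Kε at most 1, so quadratic error terms are absorbed;
  -- c₀/2 makes the accumulated phase exceed 2 > π/2, which excludes n ≤ 0.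
  refine ⟨5 * K, by positivity, min (1 / K) (c₀ / 2), by positivity,
    fun ε En xm xp hε hε₀ hE hE1 h => ⟨fun hc => ?_, fun ⟨k, hk⟩ => ?_⟩⟩
  · have hη : K * ε ≤ 1 := by
      have := (lt_min_iff.1 hε₀).1
      rw [lt_div_iff₀ hK] at this
      linarith
    obtain ⟨n, h1, h2⟩ := exists_int_abs_sub_mul_pi_le (hc.norm_exp_sub_one_le hη hm hσ hε h)
    have hpos : 2 < accumulatedPhase m ε En xm xp := by
      rw [h.accumulatedPhase_eq hm, lt_div_iff₀ hε]
      linarith [(lt_min_iff.1 hε₀).2, hlow En xm xp hE h]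
    have hn : 0 < n := by
      have h3 := (abs_le.1 h1).2
      have h4 := Real.pi_lt_d2
      have h5 := Real.pi_pos
      by_contra! hn
      have : (n : ℝ) ≤ 0 := by exact_mod_cast hn
      nlinarith
    rw [← mul_assoc] at h2
    rcases hσ with rfl | rfl
    -- For σ = 1 the labelling starts at π, so n ≥ 1 is exactly what makes k = n - 1 a natural
    -- number.
    · obtain ⟨k, rfl⟩ : ∃ k : ℕ, n = k + 1 := ⟨(n - 1).toNat, by omega⟩
      push_cast at h2
      refine ⟨k, ?_, fun h => absurd h (by norm_num), fun _ => h2⟩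
      convert h2 using 3
      norm_num
    · obtain ⟨k, rfl⟩ := Int.eq_ofNat_of_zero_le hn.le
      push_cast at h2
      refine ⟨k, ?_, fun _ => h2, fun h => absurd h (by norm_num)⟩
      convert h2 using 3
      norm_num
  · refine globallyConsistent_of_norm_exp_sub_one_le hm hσ hε hE1 h ?_
    set δ := accumulatedPhase m ε En xm xp - (k + ((σ : ℝ) + 1) / 2) * Real.pi with hδ
    have e1 : cexp (I * ((2 * accumulatedPhase m ε En xm xp : ℝ) : ℂ))
        = cexp (I * ((2 * δ : ℝ) : ℂ)) := by
      -- As (σ + 1)/2 is an integer, twice the quantised phase is a multiple of 2π and only the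
      -- deviation δ remains.
      rw [Complex.exp_eq_exp_iff_exists_int]
      rcases hσ with rfl | rfl
      · refine ⟨k + 1, ?_⟩
        rw [hδ]; push_cast; ring
      · refine ⟨k, ?_⟩
        rw [hδ]; push_cast; ring
    rw [e1]
    refine Real.norm_exp_I_mul_ofReal_sub_one_le.trans ?_
    rw [norm_mul, Real.norm_eq_abs, Real.norm_eq_abs, abs_two]
    nlinarith
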